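/- Let $n_0\ge 0$ be an integer and let $\lambda=(n)$ be the frequency $n_0, n_0+1, n_0+2,\dots$ (the usual choices being $n_0=0$, the power series case, and $n_0=1$). Let $\ell\ge 0$. Let $H_{\infty,\ell}^{(n)}[\mathrm{Re}>0]$ be the space of all holomorphic functions $f$ on $[\mathrm{Re}>0]=\{s\in\mathbb C:\mathrm{Re}\,s>0\}$ such that $$\|f\|_{\infty,\ell}=\sup_{\mathrm{Re}\,s>0}\frac{|f(s)|}{(1+|s|)^\ell}<\infty$$ and which have a $\lambda$-Riesz germ, i.e. there are complex coefficients $(a_n)_{n\ge n_0}$ and numbers $m\ge 0$, $\sigma\ge 0$ with $$f(s)=\lim_{x\to\infty}\sum_{n_0\le n<x}a_n e^{-ns}\Big(1-\frac nx\Big)^m\qquad\text{for all } s \text{ with } \mathrm{Re}\,s>\sigma .$$ Let $H_{\infty}^{(n)}[\mathrm{Re}>0]$ be the space of all bounded holomorphic functions $f$ on $[\mathrm{Re}>0]$, with norm $\|f\|_\infty=\sup_{\mathrm{Re}\,s>0}|f(s)|$, such that for every $\sigma>0$ the function $t\mapsto f(\sigma+it)$ is uniformly almost periodic on $\mathbb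 R$ in the sense of Bohr, and whose Bohr coefficients $$a_x(f)=\lim_{T\to\infty}\frac1{2T}\int_{-T}^{T}f(\sigma+it)\,e^{(\sigma+it)x}\,dt,\qquad x\in\mathbb R$$ (which do not depend on $\sigma>0$) vanish for every $x\notin\{n_0,n_0+1,n_0+2,\dots\}$. Then $$H_{\infty,\ell}^{(n)}[\mathrm{Re}>0]=H_{\infty}^{(n)}[\mathrm{Re}>0],$$ with equivalent norms: there is a constant $C=C(n_0,\ell)$ such that $\|f\|_{\infty,\ell}\le\|f\|_\infty\le C\,\|f\|_{\infty,\ell}$ for all $f$ in this space. In particular, the scale $\ell\mapsto H_{\infty,\ell}^{(n)}[\mathrm{Re}>0]$ collapses: all these spaces coincide. -/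

import Mathlib

open Filter Topology

namespace RieszScale

/-- A frequency: a strictly increasing, non-negative, unbounded real sequence
(indexed from `0`). -/
structure Frequency where
  /-- The underlying sequence. -/
  seq : ℕ → ℝ
  nonneg : ∀ n, 0 ≤ seq n
  strictMono : StrictMono seq
  tendsto : Tendsto seq atTop atTop

theorem Frequency.finite_lt (lam : Frequency) (x : ℝ) : {n : ℕ | lam.seq n < x}.Finite := by
  obtain ⟨N, hN⟩ := (lam.tendsto.eventually_ge_atTop x).exists_forall_of_atTop
  refine (Set.finite_lt_nat N).subset fun n hn => ?_
  by_contra h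
  exact absurd (hN n (not_lt.mp h)) (not_le.mpr hn)

/-- The frequency `n₀, n₀ + 1, n₀ + 2, …`; for `n₀ = 0` the substitution `z = exp (-s)` turns its
Dirichlet series into the power series in `z`. -/
def powerFrequency (n₀ : ℕ) : Frequency where
  seq n := ((n₀ + n : ℕ) : ℝ)
  nonneg n := Nat.cast_nonneg _
  strictMono m n h := by
    have : n₀ + m < n₀ + n := by omega
    exact Nat.cast_lt.mpr this
  tendsto := by
    refine tendsto_natCast_atTop_atTop.comp ?_
    exact tendsto_atTop_mono (fun n => Nat.le_add_left n n₀) tendsto_id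

/-- The open right half-plane `[Re > 0]`. -/
def rightHalfPlane : Set ℂ := {s : ℂ | 0 < s.re}

/-- The Riesz mean of order `k` of the Dirichlet series `∑ aₙ exp (-λₙ s)`:
`∑_{λₙ < x} aₙ exp (-λₙ s) (1 - λₙ / x) ^ k`. -/
noncomputable def rieszMean (lam : Frequency) (k : ℝ) (a : ℕ → ℂ) (x : ℝ) (s : ℂ) : ℂ :=
  ∑ n ∈ (lam.finite_lt x).toFinset,
    a n * Complex.exp (-(lam.seq n : ℂ) * s) * (((1 - lam.seq n / x) ^ k : ℝ) : ℂ)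

/-- The Dirichlet series `∑ aₙ exp (-λₙ s)` is a Riesz germ of `f`: on some half-plane inside
`[Re > 0]` its Riesz means of some order `m ≥ 0` converge pointwise to `f`. -/
def IsRieszGerm (lam : Frequency) (a : ℕ → ℂ) (f : ℂ → ℂ) : Prop :=
  ∃ m : ℝ, 0 ≤ m ∧ ∃ σ : ℝ, 0 ≤ σ ∧ ∀ s : ℂ, σ < s.re →
    Tendsto (fun x : ℝ => rieszMean lam m a x s) atTop (𝓝 (f s))

/-- The weighted norm `sup_{Re s > 0} |f s| / (1 + |s|) ^ ℓ`. -/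
noncomputable def scaleNorm (ℓ : ℝ) (f : ℂ → ℂ) : ℝ :=
  ⨆ s : rightHalfPlane, ‖f s‖ / (1 + ‖(s : ℂ)‖) ^ ℓ

/-- The space `H_{∞,ℓ}^λ[Re > 0]`. A function on the half-plane is represented by a function on `ℂ`;
only its values on the half-plane enter. -/
def HInftyScale (lam : Frequency) (ℓ : ℝ) : Set (ℂ → ℂ) :=
  {f | DifferentiableOn ℂ f rightHalfPlane ∧
    (∃ a : ℕ → ℂ, IsRieszGerm lam a f) ∧
    BddAbove (Set.range fun s : rightHalfPlane => ‖f s‖ / (1 + ‖(s : ℂ)‖) ^ ℓ)}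

/-- Uniformly almost periodic functions on `ℝ` in the sense of Bohr: continuous, and for every
`ε > 0` the set of `ε`-almost periods is relatively dense. -/
def UniformlyAlmostPeriodic (g : ℝ → ℂ) : Prop :=
  Continuous g ∧ ∀ ε : ℝ, 0 < ε → ∃ L : ℝ, 0 < L ∧ ∀ b : ℝ, ∃ τ ∈ Set.Icc b (b + L),
    ∀ t : ℝ, ‖g (t + τ) - g t‖ ≤ ε

/-- `c` is the Bohr coefficient of `f` at `x`: on each vertical line `[Re = σ]`, `σ > 0`,
`c = lim_{T → ∞} (1 / 2T) ∫_{-T}^{T} f (σ + it) exp ((σ + it) x) dt`. -/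
def HasBohrCoeff (f : ℂ → ℂ) (x : ℝ) (c : ℂ) : Prop :=
  ∀ σ : ℝ, 0 < σ →
    Tendsto (fun T : ℝ => (1 / (2 * T) : ℂ) *
        ∫ t in (-T)..T, f (σ + t * Complex.I) * Complex.exp ((σ + t * Complex.I) * x))
      atTop (𝓝 c)

/-- The sup norm on the right half-plane. -/
noncomputable def supNorm (f : ℂ → ℂ) : ℝ := ⨆ s : rightHalfPlane, ‖f s‖

/-- The space `H_∞^λ[Re > 0]`: bounded holomorphic functions on the right half-plane which are
uniformly almost periodic on every vertical line and whose Bohr coefficients are supported in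
`{λₙ}`. -/
def HInfty (lam : Frequency) : Set (ℂ → ℂ) :=
  {f | DifferentiableOn ℂ f rightHalfPlane ∧
    BddAbove (Set.range fun s : rightHalfPlane => ‖f s‖) ∧
    (∀ σ : ℝ, 0 < σ → UniformlyAlmostPeriodic fun t : ℝ => f (σ + t * Complex.I)) ∧
    ∀ x : ℝ, x ∉ Set.range lam.seq → HasBohrCoeff f x 0}

end RieszScale

/-! Both spaces consist of the functions `f s = F (exp (-s))` with `F` holomorphic in the unit disc
and without Taylor terms below `n₀` (`IsPowerSeriesLift`), subject to a growth condition. The growth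
conditions agree by the maximum principle: every point of the circle of radius `exp (-σ)`, `σ ≤ 1`,
is `exp (-s)` with `Re s = σ` and `|Im s| ≤ π`, where the weight is at most `(2 + π) ^ ℓ`
(`norm_le_of_norm_div_le`).

The lift `F` exists once `f` is `2πi`-periodic and bounded far to the right. A Riesz germ has
coefficients of at most exponential growth, so its series converges absolutely far to the right; `f`
is periodic there, hence everywhere by the identity theorem.

For almost periodic `f`, periodicity is a uniqueness theorem (`translation_two_pi_eq_self`). On a
vertical line let `u` be the restriction of `f`, `R` the translation by `2π` and `v = R u - u`; all
Bohr means of `v` vanish. If `v ≠ 0`, the precompact orbit of `v` under the isometry `R` has a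
unimodular eigenvector in its closed span. Up to an exponential factor this eigenvector is
`2π`-periodic, and its Fourier coefficients are Bohr means, hence zero: a contradiction. -/

namespace RieszScale

/-! ### Eigenvectors of isometries with precompact orbits -/

section Eigenvector

variable {X : Type*} [NormedAddCommGroup X] [NormedSpace ℂ X]

theorem sum_stdAddChar_mul {Q : ℕ} [NeZero Q] (b : ZMod Q) :
    ∑ q : ZMod Q, ZMod.stdAddChar (q * b) = if b = 0 then (Q : ℂ) else 0 := by
  have := AddChar.sum_mulShift b (ZMod.isPrimitive_stdAddChar Q)
  rw [ZMod.card] at this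
  rw [this]
  split_ifs <;> simp

theorem natCast_zmod_inj {Q a b : ℕ} (ha : a < Q) (hb : b < Q) :
    (a : ZMod Q) - b = 0 ↔ a = b := by
  rw [sub_eq_zero, ZMod.natCast_eq_natCast_iff', Nat.mod_eq_of_lt ha, Nat.mod_eq_of_lt hb]

/-- Finite Parseval identity for the exponential sum over a set of integers. -/
theorem sum_norm_sq_expSum {Q : ℕ} [NeZero Q] (S : Finset ℕ) (hS : ∀ j ∈ S, j < Q) :
    ∑ q : ZMod Q, ‖∑ k ∈ S, ZMod.stdAddChar (q * -(k : ZMod Q))‖ ^ 2 = (Q : ℝ) * S.card := by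
  have key : ∀ q : ZMod Q,
      ((‖∑ k ∈ S, ZMod.stdAddChar (q * -(k : ZMod Q))‖ ^ 2 : ℝ) : ℂ) =
        ∑ k ∈ S, ∑ j ∈ S, ZMod.stdAddChar (q * ((j : ZMod Q) - (k : ZMod Q))) := by
    intro q
    rw [Complex.ofReal_pow, ← Complex.mul_conj', map_sum, Finset.sum_mul_sum]
    refine Finset.sum_congr rfl fun k _ => Finset.sum_congr rfl fun j _ => ?_
    rw [← AddChar.map_neg_eq_conj, ← AddChar.map_add_eq_mul]
    congr 1
    ring
  apply Complex.ofReal_injective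
  rw [Complex.ofReal_sum, Finset.sum_congr rfl fun q _ => key q, Finset.sum_comm,
    Finset.sum_congr rfl fun k _ => Finset.sum_comm]
  simp_rw [sum_stdAddChar_mul]
  have : ∀ k ∈ S, ∑ j ∈ S, (if (j : ZMod Q) - (k : ZMod Q) = 0 then (Q : ℂ) else 0) = Q := by
    intro k hk
    rw [Finset.sum_eq_single_of_mem k hk]
    · simp
    · intro j hj hjk
      rw [if_neg]
      rwa [natCast_zmod_inj (hS j hj) (hS k hk)]
  rw [Finset.sum_congr rfl this]
  simp [mul_comm]

/-- Squaring the exponential sum without conjugation produces the frequencies `-(j + k)`, and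
orthogonality selects `n ≡ j + k` modulo `Q`. Since `Q = 2 * N`, no sum `j + k` wraps around. -/
theorem sum_expSum_sq_smul {Q N : ℕ} [NeZero Q] (hQ : Q = 2 * N) (S : Finset ℕ)
    (hS : ∀ j ∈ S, j < N) (w : ℕ → X) :
    ∑ q : ZMod Q, (∑ k ∈ S, ZMod.stdAddChar (q * -(k : ZMod Q))) ^ 2 •
        ∑ n ∈ Finset.range Q, ZMod.stdAddChar q ^ n • w n
      = (Q : ℂ) • ∑ j ∈ S, ∑ k ∈ S, w (j + k) := by
  have key : ∀ q : ZMod Q, (∑ k ∈ S, ZMod.stdAddChar (q * -(k : ZMod Q))) ^ 2 •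
        ∑ n ∈ Finset.range Q, ZMod.stdAddChar q ^ n • w n =
      ∑ j ∈ S, ∑ k ∈ S, ∑ n ∈ Finset.range Q,
        ZMod.stdAddChar (q * ((n : ZMod Q) - ((j + k : ℕ) : ZMod Q))) • w n := by
    intro q
    rw [sq, Finset.sum_mul_sum, Finset.sum_smul]
    refine Finset.sum_congr rfl fun j _ => ?_
    rw [Finset.sum_smul]
    refine Finset.sum_congr rfl fun k _ => ?_
    rw [Finset.smul_sum]
    refine Finset.sum_congr rfl fun n _ => ?_
    rw [smul_smul, ← AddChar.map_nsmul_eq_pow, ← AddChar.map_add_eq_mul,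
      ← AddChar.map_add_eq_mul]
    congr 2
    push_cast [nsmul_eq_mul]
    ring
  rw [Finset.sum_congr rfl fun q _ => key q, Finset.sum_comm, Finset.smul_sum]
  refine Finset.sum_congr rfl fun j hj => ?_
  rw [Finset.sum_comm, Finset.smul_sum]
  refine Finset.sum_congr rfl fun k hk => ?_
  rw [Finset.sum_comm]
  simp_rw [← Finset.sum_smul, sum_stdAddChar_mul]
  have hjk : j + k < Q := by have := hS j hj; have := hS k hk; omega
  rw [Finset.sum_eq_single_of_mem (j + k) (Finset.mem_range.2 hjk)]
  · simp
  · intro n hn hne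
    rw [if_neg, zero_smul]
    rwa [natCast_zmod_inj (Finset.mem_range.1 hn) hjk]

/-- If `w (j + k)` is close to `v` for all `j, k` in a large set `S`, then some exponential sum
of `w` is large. -/
theorem exists_norm_expSum_ge {N : ℕ} (S : Finset ℕ) (hS : ∀ j ∈ S, j < N) (w : ℕ → X) (v : X)
    (hw : ∀ j ∈ S, ∀ k ∈ S, ‖w (j + k) - v‖ ≤ ‖v‖ / 2) :
    ∃ z : ℂ, ‖z‖ = 1 ∧
      S.card * (‖v‖ / 2) ≤ ‖∑ n ∈ Finset.range (2 * N), z ^ n • w n‖ := by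
  rcases S.eq_empty_or_nonempty with rfl | hne
  · exact ⟨1, by simp, by simp⟩
  obtain ⟨j₀, hj₀⟩ := hne
  have hN : 0 < N := (Nat.zero_le _).trans_lt (hS j₀ hj₀)
  obtain ⟨Q, hQ⟩ : ∃ Q, Q = 2 * N := ⟨_, rfl⟩
  have : NeZero Q := ⟨by omega⟩
  by_contra! hcon
  rw [← hQ] at hcon
  have hid := sum_expSum_sq_smul hQ S hS w
  have hpar := sum_norm_sq_expSum (Q := Q) S fun j hj => (hS j hj).trans (by omega)
  have hQ0 : (0 : ℝ) < Q := by exact_mod_cast Nat.pos_of_ne_zero (NeZero.ne Q)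
  have hS0 : (0 : ℝ) < S.card := by exact_mod_cast Finset.card_pos.2 ⟨j₀, hj₀⟩
  have hlow : (S.card : ℝ) ^ 2 * (‖v‖ / 2) ≤ ‖∑ j ∈ S, ∑ k ∈ S, w (j + k)‖ := by
    have h1 : ‖(∑ j ∈ S, ∑ k ∈ S, w (j + k)) - ∑ j ∈ S, ∑ k ∈ S, v‖
        ≤ (S.card : ℝ) ^ 2 * (‖v‖ / 2) := by
      rw [← Finset.sum_sub_distrib]
      simp_rw [← Finset.sum_sub_distrib]
      refine (norm_sum_le_of_le S fun j hj => norm_sum_le_of_le S fun k hk => hw j hj k hk).trans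
        (le_of_eq ?_)
      simp only [Finset.sum_const, nsmul_eq_mul]
      ring
    have h2 : ‖∑ j ∈ S, ∑ k ∈ S, v‖ = (S.card : ℝ) ^ 2 * ‖v‖ := by
      simp only [Finset.sum_const, smul_smul]
      rw [RCLike.norm_nsmul ℂ]
      push_cast [nsmul_eq_mul]
      ring
    have h3 := norm_sub_norm_le (∑ j ∈ S, ∑ k ∈ S, v) (∑ j ∈ S, ∑ k ∈ S, w (j + k))
    rw [norm_sub_rev] at h3
    linarith
  -- By Parseval the weights `|E q| ^ 2` of the exponential sums `E q` over `S` add up to `Q * |S|`,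
  -- so if every exponential sum of `w` were small, this weighted sum would fall below the bound
  -- `hlow`.
  have hup : ‖(Q : ℂ) • ∑ j ∈ S, ∑ k ∈ S, w (j + k)‖ < Q * S.card * (S.card * (‖v‖ / 2)) := by
    rw [← hid, ← hpar, Finset.sum_mul]
    refine (norm_sum_le _ _).trans_lt (Finset.sum_lt_sum ?_ ?_)
    · intro q _
      rw [norm_smul, norm_pow]
      exact mul_le_mul_of_nonneg_left (hcon _ (AddChar.norm_apply _ _)).le (by positivity)
    -- Strictness needs one nonzero weight; at `q = 0` the sum over `S` is `|S|`.
    · have : ∃ q : ZMod Q, q ∈ Finset.univ ∧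
          0 < ‖∑ k ∈ S, ZMod.stdAddChar (q * -(k : ZMod Q))‖ ^ 2 :=
        ⟨0, Finset.mem_univ _, by simpa using pow_pos hS0 2⟩
      obtain ⟨q, hq, hpos⟩ := this
      refine ⟨q, hq, ?_⟩
      rw [norm_smul, norm_pow]
      exact mul_lt_mul_of_pos_left (hcon _ (AddChar.norm_apply _ _)) hpos
  rw [norm_smul, Complex.norm_natCast] at hup
  have := mul_le_mul_of_nonneg_left hlow hQ0.le
  nlinarith

/-- Almost periods of an isometry along a totally bounded orbit have positive density. -/
theorem exists_almostPeriods (R : X →ₗᵢ[ℂ] X) (v : X)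
    (h : TotallyBounded (Set.range fun n : ℕ => R^[n] v)) {ε : ℝ} (hε : 0 < ε) :
    ∃ m : ℕ, 0 < m ∧ ∀ N : ℕ, ∃ S : Finset ℕ, (∀ j ∈ S, j < N) ∧ (N : ℝ) / m ≤ S.card ∧
      ∀ j ∈ S, ∀ k ∈ S, ‖R^[j + k] v - v‖ ≤ ε := by
  obtain ⟨t, ht, hcov⟩ := Metric.totallyBounded_iff.1 h (ε / 4) (by positivity)
  have hch : ∀ n : ℕ, ∃ y ∈ t, R^[n] v ∈ Metric.ball y (ε / 4) := by
    intro n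
    simpa using hcov (Set.mem_range_self n)
  choose p hpt hp using hch
  have htne : ht.toFinset.Nonempty := ⟨p 0, by simpa using hpt 0⟩
  refine ⟨ht.toFinset.card, Finset.card_pos.2 htne, fun N => ?_⟩
  have hm0 : (0 : ℝ) < ht.toFinset.card := by exact_mod_cast Finset.card_pos.2 htne
  classical
  -- Pigeonhole: one point of the finite net is close to `R^[n] v` for at least `N / m` of the times
  -- `n < N`, where `m` is the size of the net.
  obtain ⟨y, -, hy⟩ := Finset.exists_le_card_fiber_of_nsmul_le_card_of_maps_to
    (s := Finset.range N) (t := ht.toFinset) (f := p) (b := (N : ℝ) / ht.toFinset.card)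
    (fun n _ => by simpa using hpt n) htne (by
      rw [nsmul_eq_mul, Finset.card_range]
      field_simp
      exact le_rfl)
  set T := (Finset.range N).filter fun n => p n = y with hT
  rcases T.eq_empty_or_nonempty with h0 | hTne
  · exact ⟨∅, by simp, by simpa [h0] using hy, by simp⟩
  have hmin := T.min'_mem hTne
  set j₀ := T.min' hTne
  have hadd : ∀ (j : ℕ) (x y : X), ‖R^[j] x - R^[j] y‖ = ‖x - y‖ := by
    intro j x y
    induction j with
    | zero => rfl
    | succ j ih =>
      rw [Function.iterate_succ_apply', Function.iterate_succ_apply', ← map_sub, R.norm_map, ih]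
  -- Two times in the same ball differ by an `ε / 2`-almost period, because the isometry `R^[j₀]`
  -- can be cancelled. The factor `1 / 2` leaves room for adding two such differences.
  have hone : ∀ n ∈ T, ‖R^[n - j₀] v - v‖ ≤ ε / 2 := by
    intro n hn
    have hle : j₀ ≤ n := T.min'_le n hn
    rw [← hadd j₀, ← Function.iterate_add_apply, Nat.add_sub_cancel' hle]
    have h1 := hp n
    have h2 := hp j₀
    rw [(Finset.mem_filter.1 hn).2] at h1
    rw [(Finset.mem_filter.1 hmin).2] at h2
    rw [← dist_eq_norm]
    have := dist_triangle_right (R^[n] v) (R^[j₀] v) y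
    have h1' := Metric.mem_ball.1 h1
    have h2' := Metric.mem_ball.1 h2
    linarith
  refine ⟨T.image fun n => n - j₀, ?_, ?_, ?_⟩
  · intro j hj
    obtain ⟨n, hn, rfl⟩ := Finset.mem_image.1 hj
    have := Finset.mem_range.1 (Finset.mem_filter.1 hn).1
    omega
  · rw [Finset.card_image_of_injOn]
    · exact hy
    · intro a ha b hb hab
      have h1 : j₀ ≤ a := T.min'_le a ha
      have h2 : j₀ ≤ b := T.min'_le b hb
      simp only at hab
      omega
  · intro j hj k hk
    obtain ⟨a, ha, rfl⟩ := Finset.mem_image.1 hj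
    obtain ⟨b, hb, rfl⟩ := Finset.mem_image.1 hk
    have h1 := hone a ha
    have h2 := hone b hb
    rw [← hadd (a - j₀), ← Function.iterate_add_apply] at h2
    calc _ ≤ ‖R^[a - j₀ + (b - j₀)] v - R^[a - j₀] v‖ + ‖R^[a - j₀] v - v‖ :=
          norm_sub_le_norm_sub_add_norm_sub _ _ _
      _ ≤ ε := by linarith

/-- A linear isometry has an eigenvector in the closed span of any nonzero vector with totally
bounded orbit. -/
theorem exists_eigenvector_of_totallyBounded [CompleteSpace X] (R : X →ₗᵢ[ℂ] X) (v : X)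
    (hv : v ≠ 0) (h : TotallyBounded (Set.range fun n : ℕ => R^[n] v)) :
    ∃ g : X, g ≠ 0 ∧ g ∈ (Submodule.span ℂ (Set.range fun n : ℕ => R^[n] v)).topologicalClosure ∧
      ∃ z : ℂ, ‖z‖ = 1 ∧ R g = z • g := by
  have hv0 : 0 < ‖v‖ := norm_pos_iff.2 hv
  obtain ⟨m, hm, hS⟩ := exists_almostPeriods R v h (half_pos hv0)
  have hm0 : (0 : ℝ) < m := by exact_mod_cast hm
  -- The averages `g N` below lie in the closed convex hull of the unit-disc multiples of the orbit
  -- closure, which is compact.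
  set O : Set X := (fun p : ℂ × X => p.1 • p.2) ''
    (Metric.closedBall 0 1 ×ˢ closure (Set.range fun n : ℕ => R^[n] v)) with hO
  have hOc : IsCompact O := by
    refine IsCompact.image ?_ continuous_smul
    exact (isCompact_closedBall 0 1).prod
      (h.closure.isCompact_of_isClosed isClosed_closure)
  set K := closure (convexHull ℝ O) with hK
  have hKc : IsCompact K :=
    hOc.totallyBounded.convexHull.closure.isCompact_of_isClosed isClosed_closure
  have hKs : K ⊆ (Submodule.span ℂ (Set.range fun n : ℕ => R^[n] v)).topologicalClosure := by
    refine closure_minimal (convexHull_min ?_ ?_) (Submodule.isClosed_topologicalClosure _)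
    · rintro _ ⟨⟨z, x⟩, ⟨-, hx⟩, rfl⟩
      exact Submodule.smul_mem _ _ (closure_mono Submodule.subset_span hx)
    · exact ((Submodule.span ℂ (Set.range fun n : ℕ => R^[n] v)).topologicalClosure.restrictScalars
        ℝ).convex
  have hex : ∀ N : ℕ, ∃ z : ℂ, ‖z‖ = 1 ∧ (((N + 1 : ℕ) : ℝ) / m) * (‖v‖ / 2) ≤
      ‖∑ n ∈ Finset.range (2 * (N + 1)), z ^ n • R^[n] v‖ := by
    intro N
    obtain ⟨S, h1, h2, h3⟩ := hS (N + 1)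
    obtain ⟨z, hz, hle⟩ := exists_norm_expSum_ge S h1 (fun n => R^[n] v) v h3
    exact ⟨z, hz, (mul_le_mul_of_nonneg_right h2 (by positivity)).trans hle⟩
  choose z hz hle using hex
  set c : ℕ → ℝ := fun N => 1 / ((2 * (N + 1) : ℕ) : ℝ) with hc
  have hcpos : ∀ N, 0 < c N := fun N => by
    have : (0 : ℝ) < ((2 * (N + 1) : ℕ) : ℝ) := by positivity
    simp only [hc]; positivity
  set g : ℕ → X := fun N => (c N : ℂ) • ∑ n ∈ Finset.range (2 * (N + 1)), z N ^ n • R^[n] v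
    with hg
  have hgK : ∀ N, g N ∈ K := by
    intro N
    apply subset_closure
    have : g N = ∑ n ∈ Finset.range (2 * (N + 1)), c N • (z N ^ n • R^[n] v) := by
      simp only [hg]
      rw [Complex.coe_smul, Finset.smul_sum]
    rw [this]
    refine (convex_convexHull ℝ O).sum_mem (fun _ _ => (hcpos N).le) ?_ ?_
    · rw [Finset.sum_const, Finset.card_range, nsmul_eq_mul]
      simp only [hc]
      have : ((2 * (N + 1) : ℕ) : ℝ) ≠ 0 := by positivity
      field_simp
    · intro n _
      refine subset_convexHull ℝ O ⟨(z N ^ n, R^[n] v), ⟨?_, subset_closure ⟨n, rfl⟩⟩, rfl⟩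
      simp [hz]
  -- Positive density of the almost periods bounds the averages away from zero, so their limit is
  -- not zero.
  have hglow : ∀ N, ‖v‖ / (4 * m) ≤ ‖g N‖ := by
    intro N
    simp only [hg]
    rw [norm_smul, Complex.norm_real, Real.norm_of_nonneg (hcpos N).le]
    refine le_trans (le_of_eq ?_) (mul_le_mul_of_nonneg_left (hle N) (hcpos N).le)
    simp only [hc]
    push_cast
    have : (N : ℝ) + 1 ≠ 0 := by positivity
    field_simp
    ring
  -- The sum telescopes, so the average is an approximate eigenvector with error `O(1 / N)`.
  have hrel : ∀ N, ‖z N • R (g N) - g N‖ ≤ c N * (2 * ‖v‖) := by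
    intro N
    have hnn : ∀ n : ℕ, ‖R^[n] v‖ = ‖v‖ := by
      intro n
      induction n with
      | zero => rfl
      | succ n ih => rw [Function.iterate_succ_apply', R.norm_map, ih]
    have : z N • R (g N) - g N = (c N : ℂ) • (z N ^ (2 * (N + 1)) • R^[2 * (N + 1)] v - v) := by
      have h2 := Finset.sum_range_sub (fun n => z N ^ n • R^[n] v) (2 * (N + 1))
      simp only [pow_zero, Function.iterate_zero, id_eq, one_smul] at h2
      rw [← h2, Finset.sum_sub_distrib, smul_sub]
      simp only [hg]
      congr 1
      rw [map_smul, map_sum, smul_comm, Finset.smul_sum]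
      congr 1
      refine Finset.sum_congr rfl fun n _ => ?_
      rw [map_smul, smul_smul, ← pow_succ', Function.iterate_succ_apply']
    rw [this, norm_smul, Complex.norm_real, Real.norm_of_nonneg (hcpos N).le]
    refine mul_le_mul_of_nonneg_left ?_ (hcpos N).le
    refine (norm_sub_le _ _).trans ?_
    rw [norm_smul, norm_pow, hz, hnn, one_pow]
    linarith
  have hc0 : Tendsto c atTop (𝓝 0) := by
    have : c = fun N : ℕ => (1 / 2 : ℝ) * (1 / ((N : ℝ) + 1)) := by
      funext N
      simp only [hc]
      push_cast
      have : (N : ℝ) + 1 ≠ 0 := by positivity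
      field_simp
    rw [this]
    simpa using tendsto_one_div_add_atTop_nhds_zero_nat.const_mul (1 / 2 : ℝ)
  obtain ⟨⟨ζ, g₀⟩, ⟨hζ, hg₀⟩, φ, hφ, hlim⟩ :=
    ((isCompact_sphere (0 : ℂ) 1).prod hKc).tendsto_subseq (x := fun N => (z N, g N))
      fun N => ⟨by simp [hz], hgK N⟩
  have hlz : Tendsto (fun N => z (φ N)) atTop (𝓝 ζ) := (continuous_fst.tendsto _).comp hlim
  have hlg : Tendsto (fun N => g (φ N)) atTop (𝓝 g₀) := (continuous_snd.tendsto _).comp hlim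
  have hζ1 : ‖ζ‖ = 1 := by simpa using hζ
  have hζ0 : ζ ≠ 0 := norm_ne_zero_iff.1 (by rw [hζ1]; exact one_ne_zero)
  refine ⟨g₀, ?_, hKs hg₀, ζ⁻¹, by simp [hζ1], ?_⟩
  · have : ‖v‖ / (4 * m) ≤ ‖g₀‖ := ge_of_tendsto' hlg.norm fun N => hglow _
    exact norm_pos_iff.1 (lt_of_lt_of_le (by positivity) this)
  · have h1 : Tendsto (fun N => z (φ N) • R (g (φ N)) - g (φ N)) atTop (𝓝 (ζ • R g₀ - g₀)) :=
      (hlz.smul ((R.continuous.tendsto _).comp hlg)).sub hlg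
    have h2 : Tendsto (fun N => z (φ N) • R (g (φ N)) - g (φ N)) atTop (𝓝 0) := by
      refine squeeze_zero_norm (fun N => hrel (φ N)) ?_
      simpa using (hc0.comp hφ.tendsto_atTop).mul_const (2 * ‖v‖)
    have := sub_eq_zero.1 (tendsto_nhds_unique h1 h2)
    rw [eq_inv_smul_iff₀ hζ0, this]

end Eigenvector

/-! ### Translations, Bohr means and the periodicity criterion -/

section AlmostPeriodic

open BoundedContinuousFunction

/-- Translation by `τ` as an isometry of the bounded continuous functions on `ℝ`. -/
noncomputable def translation (τ : ℝ) : (ℝ →ᵇ ℂ) →ₗᵢ[ℂ] (ℝ →ᵇ ℂ) where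
  toFun g := g.compContinuous ⟨fun t => t + τ, by fun_prop⟩
  map_add' _ _ := rfl
  map_smul' _ _ := rfl
  norm_map' g := by
    refine le_antisymm ((norm_le (norm_nonneg _)).2 fun t => g.norm_coe_le_norm _)
      ((norm_le (norm_nonneg _)).2 fun t => ?_)
    have := norm_coe_le_norm (g.compContinuous ⟨fun t => t + τ, by fun_prop⟩) (t - τ)
    rw [compContinuous_apply, ContinuousMap.coe_mk, sub_add_cancel] at this
    exact this

@[simp]
theorem translation_apply (τ : ℝ) (g : ℝ →ᵇ ℂ) (t : ℝ) : translation τ g t = g (t + τ) := rfl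

theorem iterate_translation_apply (τ : ℝ) (g : ℝ →ᵇ ℂ) (n : ℕ) (t : ℝ) :
    ((translation τ)^[n] g) t = g (t + n * τ) := by
  induction n generalizing t with
  | zero => simp
  | succ n ih =>
    rw [Function.iterate_succ_apply', translation_apply, ih]
    push_cast
    ring_nf

/-- An almost period carries any two nearby points into the fixed interval `[-1, L + 1]`, where
compactness gives uniform continuity. -/
theorem UniformlyAlmostPeriodic.uniformContinuous {g : ℝ → ℂ} (hg : UniformlyAlmostPeriodic g) :
    UniformContinuous g := by
  rw [Metric.uniformContinuous_iff]
  intro ε hε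
  obtain ⟨L, -, hL⟩ := hg.2 (ε / 4) (by positivity)
  have huc := (isCompact_Icc (a := (-1 : ℝ)) (b := L + 1)).uniformContinuousOn_of_continuous
    hg.1.continuousOn
  obtain ⟨δ, hδ, h⟩ := Metric.uniformContinuousOn_iff.1 huc (ε / 4) (by positivity)
  refine ⟨min δ 1, by positivity, fun a b hab => ?_⟩
  obtain ⟨τ, hτ, hp⟩ := hL (-a)
  have hab' := abs_lt.1 (Real.dist_eq a b ▸ hab.trans_le (min_le_right _ _))
  have h1 := h (a + τ) ⟨by linarith [hτ.1], by linarith [hτ.2]⟩ (b + τ)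
    ⟨by linarith [hτ.1], by linarith [hτ.2]⟩ (by simpa using hab.trans_le (min_le_left _ _))
  have h2 := hp a
  have h3 := hp b
  rw [← dist_eq_norm, dist_comm] at h2
  rw [← dist_eq_norm] at h3
  have := dist_triangle4 (g a) (g (a + τ)) (g (b + τ)) (g b)
  linarith

theorem continuous_translation {g : ℝ →ᵇ ℂ} (hg : UniformContinuous g) :
    Continuous fun τ => translation τ g := by
  rw [Metric.continuous_iff]
  intro b ε hε
  obtain ⟨δ, hδ, h⟩ := Metric.uniformContinuous_iff.1 hg (ε / 2) (by positivity)
  refine ⟨δ, hδ, fun a hab => lt_of_le_of_lt ?_ (half_lt_self hε)⟩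
  refine (dist_le (by positivity)).2 fun t => ?_
  exact (h (by simpa using hab)).le

/-- The translates of an almost periodic function form a totally bounded set. -/
theorem UniformlyAlmostPeriodic.totallyBounded_range_translation {g : ℝ →ᵇ ℂ}
    (hg : UniformlyAlmostPeriodic g) : TotallyBounded (Set.range fun τ => translation τ g) := by
  rw [Metric.totallyBounded_iff]
  intro ε hε
  obtain ⟨L, -, hL⟩ := hg.2 (ε / 2) (by positivity)
  have hc : IsCompact ((fun τ => translation τ g) '' Set.Icc 0 L) :=
    isCompact_Icc.image (continuous_translation hg.uniformContinuous)
  obtain ⟨t, ht, hcov⟩ := Metric.totallyBounded_iff.1 hc.totallyBounded (ε / 2) (by positivity)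
  refine ⟨t, ht, ?_⟩
  rintro _ ⟨b, rfl⟩
  -- Up to `ε / 2`, the translation by `b` may be replaced by one with parameter in `[0, L]`.
  obtain ⟨τ, hτ, hp⟩ := hL (-b)
  have hmem : translation (b + τ) g ∈ (fun τ => translation τ g) '' Set.Icc 0 L :=
    ⟨_, ⟨by linarith [hτ.1], by linarith [hτ.2]⟩, rfl⟩
  obtain ⟨y, hy, hball⟩ := Set.mem_iUnion₂.1 (hcov hmem)
  refine Set.mem_iUnion₂.2 ⟨y, hy, ?_⟩
  have h1 : dist (translation b g) (translation (b + τ) g) ≤ ε / 2 := by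
    refine (dist_le (by positivity)).2 fun s => ?_
    have := hp (s + b)
    rw [← dist_eq_norm, dist_comm] at this
    simpa [add_assoc] using this
  have h2 := Metric.mem_ball.1 hball
  rw [Metric.mem_ball]
  linarith [dist_triangle (translation b g) (translation (b + τ) g) y]

/-- The truncated Bohr mean `(1 / 2T) ∫_{-T}^{T} g t exp (i t x) dt`. -/
noncomputable def bohrMean (x T : ℝ) (g : ℝ →ᵇ ℂ) : ℂ :=
  (1 / (2 * T) : ℂ) * ∫ t in (-T)..T, g t * Complex.exp (t * Complex.I * x)

theorem norm_exp_mul_I_mul (t x : ℝ) : ‖Complex.exp (t * Complex.I * x)‖ = 1 := by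
  have : (t * Complex.I * x : ℂ) = (t * x : ℝ) * Complex.I := by push_cast; ring
  rw [this, Complex.norm_exp_ofReal_mul_I]

theorem norm_integral_mul_exp_le (g : ℝ →ᵇ ℂ) (x a b : ℝ) :
    ‖∫ t in a..b, g t * Complex.exp (t * Complex.I * x)‖ ≤ ‖g‖ * |b - a| := by
  refine intervalIntegral.norm_integral_le_of_norm_le_const fun t _ => ?_
  rw [norm_mul, norm_exp_mul_I_mul, mul_one]
  exact g.norm_coe_le_norm t

theorem intervalIntegrable_mul_exp (g : ℝ →ᵇ ℂ) (x a b : ℝ) :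
    IntervalIntegrable (fun t : ℝ => g t * Complex.exp (t * Complex.I * x))
      MeasureTheory.volume a b :=
  Continuous.intervalIntegrable (by fun_prop) _ _

theorem norm_bohrMean_le (x : ℝ) {T : ℝ} (hT : 0 < T) (g : ℝ →ᵇ ℂ) : ‖bohrMean x T g‖ ≤ ‖g‖ := by
  rw [bohrMean, norm_mul]
  have h1 := norm_integral_mul_exp_le g x (-T) T
  have h2 : ‖(1 / (2 * T) : ℂ)‖ = 1 / (2 * T) := by
    rw [norm_div, norm_mul, Complex.norm_real, Real.norm_of_nonneg hT.le]
    simp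
  rw [h2, div_mul_eq_mul_div, one_mul, div_le_iff₀ (by positivity)]
  rwa [sub_neg_eq_add, abs_of_pos (by linarith), ← two_mul] at h1

theorem bohrMean_add (x T : ℝ) (g h : ℝ →ᵇ ℂ) :
    bohrMean x T (g + h) = bohrMean x T g + bohrMean x T h := by
  simp only [bohrMean, coe_add, Pi.add_apply, add_mul]
  rw [intervalIntegral.integral_add (intervalIntegrable_mul_exp g x _ _)
    (intervalIntegrable_mul_exp h x _ _), mul_add]

theorem bohrMean_smul (x T : ℝ) (c : ℂ) (g : ℝ →ᵇ ℂ) :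
    bohrMean x T (c • g) = c * bohrMean x T g := by
  simp only [bohrMean, coe_smul, smul_eq_mul, mul_assoc]
  rw [intervalIntegral.integral_const_mul]
  ring

theorem bohrMean_sub (x T : ℝ) (g h : ℝ →ᵇ ℂ) :
    bohrMean x T (g - h) = bohrMean x T g - bohrMean x T h := by
  have := bohrMean_add x T (g - h) h
  rw [sub_add_cancel] at this
  rw [this, add_sub_cancel_right]

/-- The closed subspace of functions with vanishing Bohr mean at `x`. -/
noncomputable def bohrMeanZero (x : ℝ) : Submodule ℂ (ℝ →ᵇ ℂ) where
  carrier := {g | Tendsto (fun T => bohrMean x T g) atTop (𝓝 0)}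
  add_mem' {g h} hg hh := by
    simpa only [Set.mem_ofPred_eq, bohrMean_add, add_zero] using hg.add hh
  zero_mem' := by simp [bohrMean]
  smul_mem' c g hg := by
    simpa only [Set.mem_ofPred_eq, bohrMean_smul, mul_zero] using hg.const_mul c

theorem mem_bohrMeanZero {x : ℝ} {g : ℝ →ᵇ ℂ} :
    g ∈ bohrMeanZero x ↔ Tendsto (fun T => bohrMean x T g) atTop (𝓝 0) := Iff.rfl

/-- The truncated means are contractions for the sup norm, uniformly in `T`. -/
theorem isClosed_bohrMeanZero (x : ℝ) : IsClosed (bohrMeanZero x : Set (ℝ →ᵇ ℂ)) := by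
  refine isClosed_of_closure_subset fun g hg => ?_
  rw [SetLike.mem_coe, mem_bohrMeanZero, Metric.tendsto_atTop]
  intro ε hε
  obtain ⟨h, hh, hd⟩ := Metric.mem_closure_iff.1 hg (ε / 2) (by positivity)
  obtain ⟨T₀, hT₀⟩ := Metric.tendsto_atTop.1 (mem_bohrMeanZero.1 hh) (ε / 2) (by positivity)
  refine ⟨max T₀ 1, fun T hT => ?_⟩
  have h1 := hT₀ T ((le_max_left _ _).trans hT)
  have h2 := norm_bohrMean_le x (lt_of_lt_of_le one_pos ((le_max_right _ _).trans hT)) (g - h)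
  rw [bohrMean_sub, ← dist_eq_norm, ← dist_eq_norm] at h2
  linarith [dist_triangle (bohrMean x T g) (bohrMean x T h) 0]

/-- Moving the window of integration by `τ` only changes two end pieces of length `|τ|`, which are
negligible after division by `2T`. Neither mean needs to converge by itself. -/
theorem tendsto_bohrMean_translation_sub (x τ : ℝ) (g : ℝ →ᵇ ℂ) :
    Tendsto (fun T => bohrMean x T (translation τ g) -
      Complex.exp (-(τ * Complex.I * x)) * bohrMean x T g) atTop (𝓝 0) := by
  have hshift : ∀ T : ℝ, ∫ t in (-T)..T, translation τ g t * Complex.exp (t * Complex.I * x) =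
      Complex.exp (-(τ * Complex.I * x)) *
        ∫ t in (-T + τ)..(T + τ), g t * Complex.exp (t * Complex.I * x) := by
    intro T
    rw [← intervalIntegral.integral_comp_add_right, ← intervalIntegral.integral_const_mul]
    refine intervalIntegral.integral_congr fun t _ => ?_
    simp only [translation_apply]
    rw [mul_left_comm, ← Complex.exp_add]
    congr 2
    push_cast
    ring
  have hle : ∀ T : ℝ, 0 < T → ‖bohrMean x T (translation τ g) -
      Complex.exp (-(τ * Complex.I * x)) * bohrMean x T g‖ ≤ ‖g‖ * |τ| / T := by
    intro T hT
    rw [bohrMean, bohrMean, hshift, mul_left_comm, ← mul_sub, ← mul_sub,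
      intervalIntegral.integral_interval_sub_interval_comm (intervalIntegrable_mul_exp g x _ _)
        (intervalIntegrable_mul_exp g x _ _) (intervalIntegrable_mul_exp g x _ _)]
    have h1 := norm_integral_mul_exp_le g x (-T + τ) (-T)
    have h2 := norm_integral_mul_exp_le g x (T + τ) T
    have e1 : |-T - (-T + τ)| = |τ| := by rw [← abs_neg τ]; congr 1; ring
    have e2 : |T - (T + τ)| = |τ| := by rw [← abs_neg τ]; congr 1; ring
    rw [e1] at h1
    rw [e2] at h2
    have h3 : ‖(1 / (2 * T) : ℂ)‖ = 1 / (2 * T) := by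
      rw [norm_div, norm_mul, Complex.norm_real, Real.norm_of_nonneg hT.le]
      simp
    have h4 : ‖Complex.exp (-(τ * Complex.I * x))‖ = 1 := by
      have := norm_exp_mul_I_mul (-τ) x
      rw [← this]; congr 2; push_cast; ring
    rw [norm_mul, norm_mul, h3, h4, one_mul, div_mul_eq_mul_div, one_mul,
      div_le_div_iff₀ (by positivity) hT]
    have h5 := (norm_sub_le (∫ t in (-T + τ)..(-T), g t * Complex.exp (t * Complex.I * x))
      (∫ t in (T + τ)..T, g t * Complex.exp (t * Complex.I * x))).trans (add_le_add h1 h2)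
    nlinarith [mul_le_mul_of_nonneg_right h5 hT.le]
  refine squeeze_zero_norm' ((eventually_gt_atTop 0).mono fun T hT => hle T hT) ?_
  exact tendsto_const_nhds.div_atTop tendsto_id

theorem translation_mem_bohrMeanZero {x : ℝ} (τ : ℝ) {g : ℝ →ᵇ ℂ} (hg : g ∈ bohrMeanZero x) :
    translation τ g ∈ bohrMeanZero x := by
  have h1 := (tendsto_bohrMean_translation_sub x τ g).add
    ((mem_bohrMeanZero.1 hg).const_mul (Complex.exp (-(τ * Complex.I * x))))
  rw [mem_bohrMeanZero]
  simpa only [sub_add_cancel, mul_zero, add_zero] using h1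

/-- A bounded continuous function which is quasi-periodic for the shift by `2π` and has vanishing
Bohr means is zero. -/
theorem eq_zero_of_translation_eq_smul {g : ℝ →ᵇ ℂ} {z : ℂ} (hz : ‖z‖ = 1)
    (hg : translation (2 * Real.pi) g = z • g) (hmean : ∀ x, g ∈ bohrMeanZero x) : g = 0 := by
  have : Fact (0 < 2 * Real.pi) := ⟨Real.two_pi_pos⟩
  have hpi : (Real.pi : ℂ) ≠ 0 := by exact_mod_cast Real.pi_ne_zero
  set α : ℝ := z.arg / (2 * Real.pi) with hα
  have hzα : Complex.exp ((2 * Real.pi) * Complex.I * α) = z := by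
    have h1 := Complex.norm_mul_exp_arg_mul_I z
    rw [hz, Complex.ofReal_one, one_mul] at h1
    conv_rhs => rw [← h1]
    congr 1
    simp only [hα]
    push_cast
    field_simp
  -- With `z = exp (2πiα)`, the factor `exp (-iαt)` turns the quasi-periodic `g` into a
  -- `2π`-periodic function.
  set h : ℝ → ℂ := fun t => g t * Complex.exp (t * Complex.I * ((-α : ℝ) : ℂ)) with hh
  have hper : Function.Periodic h (2 * Real.pi) := by
    intro t
    have h1 : g (t + 2 * Real.pi) = z * g t := congrArg (fun f : ℝ →ᵇ ℂ => f t) hg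
    simp only [hh]
    rw [h1, ← hzα, mul_assoc, mul_left_comm, ← Complex.exp_add]
    congr 2
    push_cast
    ring
  have hcont : Continuous h := by simp only [hh]; fun_prop
  set H : C(AddCircle (2 * Real.pi), ℂ) := ⟨hper.lift, continuous_coinduced_dom.mpr hcont⟩ with hH
  have hcoe : ∀ t : ℝ, H (t : AddCircle (2 * Real.pi)) = h t := fun t => hper.lift_coe t
  have hcoef : ∀ n : ℤ, fourierCoeff H n = 0 := by
    intro n
    have hq : Function.Periodic (fun t : ℝ => g t * Complex.exp
        (t * Complex.I * ((-(α + n) : ℝ) : ℂ))) (2 * Real.pi) := by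
      intro t
      have := hper t
      simp only [hh] at this
      have e : ∀ t : ℝ, Complex.exp (t * Complex.I * ((-(α + n) : ℝ) : ℂ)) =
          Complex.exp (t * Complex.I * ((-α : ℝ) : ℂ)) *
            Complex.exp (-(t * Complex.I * n)) := by
        intro t
        rw [← Complex.exp_add]; congr 1; push_cast; ring
      have e2 : Complex.exp (-(((t + 2 * Real.pi : ℝ) : ℂ) * Complex.I * n)) =
          Complex.exp (-(t * Complex.I * n)) := by
        rw [Complex.exp_eq_exp_iff_exists_int]
        exact ⟨-n, by push_cast; ring⟩
      simp only
      rw [e, e, e2, ← mul_assoc, this, mul_assoc]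
    -- Along `T = 2π(N + 1)` the window consists of whole periods, so each truncated mean equals the
    -- Fourier coefficient exactly.
    have hseq : Tendsto (fun N : ℕ => bohrMean (-(α + n)) (((N + 1 : ℕ) : ℝ) * (2 * Real.pi)) g)
        atTop (𝓝 0) := by
      refine (mem_bohrMeanZero.1 (hmean (-(α + n)))).comp ?_
      refine Tendsto.atTop_mul_const Real.two_pi_pos ?_
      exact tendsto_natCast_atTop_atTop.comp (tendsto_add_atTop_nat 1)
    have hval : ∀ N : ℕ, bohrMean (-(α + n)) (((N + 1 : ℕ) : ℝ) * (2 * Real.pi)) g =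
        fourierCoeff H n := by
      intro N
      rw [fourierCoeff_eq_intervalIntegral _ _ 0, bohrMean]
      have h1 := hq.intervalIntegral_add_zsmul_eq (2 * (N + 1 : ℕ) : ℤ)
        (-(((N + 1 : ℕ) : ℝ) * (2 * Real.pi))) (fun _ _ => intervalIntegrable_mul_exp g _ _ _)
      have h2 : -(((N + 1 : ℕ) : ℝ) * (2 * Real.pi)) + (2 * (N + 1 : ℕ) : ℤ) • (2 * Real.pi) =
          ((N + 1 : ℕ) : ℝ) * (2 * Real.pi) := by
        rw [zsmul_eq_mul]; push_cast; ring
      rw [h2, hq.intervalIntegral_add_eq _ 0] at h1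
      rw [h1]
      have h3 : ∫ t in (0 : ℝ)..(0 + 2 * Real.pi), g t * Complex.exp
          (t * Complex.I * ((-(α + n) : ℝ) : ℂ)) =
          ∫ t in (0 : ℝ)..(0 + 2 * Real.pi), fourier (-n) (t : AddCircle (2 * Real.pi)) • H t := by
        refine intervalIntegral.integral_congr fun t _ => ?_
        rw [hcoe, fourier_coe_apply, smul_eq_mul]
        simp only [hh]
        rw [mul_left_comm, ← Complex.exp_add]
        congr 2
        push_cast
        field_simp
        ring
      rw [← h3, zsmul_eq_mul, Complex.real_smul]
      generalize (∫ t in (0 : ℝ)..(0 + 2 * Real.pi), g t * Complex.exp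
          (t * Complex.I * ((-(α + n) : ℝ) : ℂ))) = J
      push_cast
      have : (N : ℂ) + 1 ≠ 0 := by exact_mod_cast Nat.succ_ne_zero N
      field_simp
    simp only [hval] at hseq
    exact tendsto_nhds_unique tendsto_const_nhds hseq
  have hsum := has_pointwise_sum_fourier_series_of_summable (f := H)
    (by rw [funext hcoef]; exact summable_zero)
  ext t
  have := hsum (t : AddCircle (2 * Real.pi))
  simp only [hcoef, zero_smul, hcoe] at this
  have h0 : h t = 0 := this.unique hasSum_zero
  simpa [hh] using h0

/-- An almost periodic function whose Bohr means vanish off the integers is `2π`-periodic. -/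
theorem translation_two_pi_eq_self {u : ℝ →ᵇ ℂ} (hu : UniformlyAlmostPeriodic u)
    (hmean : ∀ x : ℝ, x ∉ Set.range ((↑) : ℤ → ℝ) → u ∈ bohrMeanZero x) :
    translation (2 * Real.pi) u = u := by
  set R := translation (2 * Real.pi) with hR
  by_contra hne
  set v := R u - u with hv
  have hv0 : v ≠ 0 := sub_ne_zero.2 hne
  have hvm : ∀ x, v ∈ bohrMeanZero x := by
    intro x
    by_cases hx : x ∈ Set.range ((↑) : ℤ → ℝ)
    · obtain ⟨n, rfl⟩ := hx
      -- At an integer `n` the translation factor is `exp (-2πin) = 1`, so the two means cancel in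
      -- the limit.
      have h1 := tendsto_bohrMean_translation_sub n (2 * Real.pi) u
      have h2 : Complex.exp (-(((2 * Real.pi : ℝ) : ℂ) * Complex.I * ((n : ℝ) : ℂ))) = 1 := by
        rw [Complex.exp_eq_one_iff]
        exact ⟨-n, by push_cast; ring⟩
      rw [h2] at h1
      rw [mem_bohrMeanZero]
      simpa only [one_mul, ← bohrMean_sub] using h1
    · exact Submodule.sub_mem _ (translation_mem_bohrMeanZero _ (hmean x hx)) (hmean x hx)
  have htb : TotallyBounded (Set.range fun n : ℕ => R^[n] v) := by
    have h1 : UniformContinuous fun g : ℝ →ᵇ ℂ => R g - g :=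
      R.isometry.uniformContinuous.sub uniformContinuous_id
    -- The orbit of `v` is the image of translates of `u` under the uniformly continuous map `g ↦ R
    -- g - g`.
    refine (hu.totallyBounded_range_translation.image h1).subset ?_
    rintro _ ⟨n, rfl⟩
    refine ⟨_, ⟨n * (2 * Real.pi), rfl⟩, ?_⟩
    ext t
    simp only [hR, hv, iterate_translation_apply, coe_sub, Pi.sub_apply, translation_apply]
    ring_nf
  obtain ⟨g, hg0, hgm, z, hz, hgz⟩ := exists_eigenvector_of_totallyBounded R v hv0 htb
  refine hg0 (eq_zero_of_translation_eq_smul hz hgz fun x => ?_)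
  refine Submodule.topologicalClosure_minimal _ (Submodule.span_le.2 ?_)
    (isClosed_bohrMeanZero x) hgm
  rintro _ ⟨n, rfl⟩
  induction n with
  | zero => exact hvm x
  | succ n ih =>
    simp only [Function.iterate_succ_apply']
    exact translation_mem_bohrMeanZero _ ih

end AlmostPeriodic

/-! ### Absolutely convergent series in `exp (-k s)` and their Bohr coefficients -/

section ExpSeries

open BoundedContinuousFunction

/-- `f` is the sum of the Dirichlet series `∑ bₖ exp (-k s)` on `[Re > c]`. -/
def HasExpSeries (b : ℕ → ℂ) (f : ℂ → ℂ) (c : ℝ) : Prop :=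
  ∀ s : ℂ, c < s.re → HasSum (fun k : ℕ => b k * Complex.exp (-(k * s))) (f s)

theorem norm_exp_neg_natCast_mul (k : ℕ) (s : ℂ) :
    ‖Complex.exp (-(k * s))‖ = Real.exp (-(k * s.re)) := by
  rw [Complex.norm_exp]; simp

theorem HasExpSeries.summable_norm {b : ℕ → ℂ} {f : ℂ → ℂ} {c σ : ℝ} (h : HasExpSeries b f c)
    (hσ : c < σ) : Summable fun k : ℕ => ‖b k‖ * Real.exp (-(k * σ)) := by
  have := (h σ (by simpa using hσ)).summable.norm
  simpa [norm_exp_neg_natCast_mul] using this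

theorem HasExpSeries.exists_norm_le {b : ℕ → ℂ} {f : ℂ → ℂ} {c σ : ℝ} (h : HasExpSeries b f c)
    (hσ : c < σ) : ∃ B : ℝ, ∀ s : ℂ, σ ≤ s.re → ‖f s‖ ≤ B := by
  refine ⟨∑' k : ℕ, ‖b k‖ * Real.exp (-(k * σ)), fun s hs => ?_⟩
  rw [← (h s (hσ.trans_le hs)).tsum_eq]
  refine tsum_of_norm_bounded (h.summable_norm hσ).hasSum fun k => ?_
  rw [norm_mul, norm_exp_neg_natCast_mul]
  gcongr

theorem HasExpSeries.add_two_pi_I {b : ℕ → ℂ} {f : ℂ → ℂ} {c : ℝ} (h : HasExpSeries b f c)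
    {s : ℂ} (hs : c < s.re) : f (s + 2 * Real.pi * Complex.I) = f s := by
  have h1 := h (s + 2 * Real.pi * Complex.I) (by simpa using hs)
  refine h1.unique ?_
  convert! h s hs using 3 with k
  rw [Complex.exp_eq_exp_iff_exists_int]
  exact ⟨-k, by push_cast; ring⟩

theorem bohrMean_zero_one {T : ℝ} (hT : 0 < T) : bohrMean 0 T 1 = 1 := by
  have : (T : ℂ) ≠ 0 := by exact_mod_cast hT.ne'
  simp only [bohrMean, Complex.ofReal_zero, mul_zero, Complex.exp_zero, coe_one, Pi.one_apply,
    mul_one, intervalIntegral.integral_const, sub_neg_eq_add, Complex.real_smul]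
  push_cast
  field_simp
  ring

/-- Translation by `π / y` fixes the constant but multiplies its mean at `y` by `-1` in the limit.
-/
theorem one_mem_bohrMeanZero {y : ℝ} (hy : y ≠ 0) : (1 : ℝ →ᵇ ℂ) ∈ bohrMeanZero y := by
  have h := tendsto_bohrMean_translation_sub y (Real.pi / y) 1
  have h1 : translation (Real.pi / y) (1 : ℝ →ᵇ ℂ) = 1 := rfl
  have h2 : Complex.exp (-((Real.pi / y : ℝ) * Complex.I * y)) = -1 := by
    have hy' : (y : ℂ) ≠ 0 := by exact_mod_cast hy
    have : (-((Real.pi / y : ℝ) * Complex.I * y) : ℂ) = -(Real.pi * Complex.I) := by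
      push_cast; field_simp
    rw [this, Complex.exp_neg, Complex.exp_pi_mul_I]
    norm_num
  rw [h1, h2] at h
  rw [mem_bohrMeanZero]
  have h3 := h.const_mul (1 / 2 : ℂ)
  rw [mul_zero] at h3
  refine h3.congr fun T => ?_
  ring

/-- Termwise integration, dominated by absolute convergence on the line; the `k`-th exponential
moves the frequency of the mean of `1` from `x` to `x - k`. -/
theorem HasExpSeries.hasSum_bohrMean {b : ℕ → ℂ} {f : ℂ → ℂ} (h : HasExpSeries b f 0) (x : ℝ)
    {σ : ℝ} (hσ : 0 < σ) (T : ℝ) :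
    HasSum (fun k : ℕ => b k * Real.exp (-(k * σ)) * Real.exp (σ * x) * bohrMean (x - k) T 1)
      ((1 / (2 * T) : ℂ) * ∫ t in (-T)..T,
        f (σ + t * Complex.I) * Complex.exp ((σ + t * Complex.I) * x)) := by
  have hsum := (h.summable_norm hσ).mul_right (Real.exp (σ * x))
  have key := intervalIntegral.hasSum_integral_of_dominated_convergence (a := -T) (b := T)
    (μ := MeasureTheory.volume)
    (F := fun (k : ℕ) (t : ℝ) => b k * Complex.exp (-(k * (σ + t * Complex.I))) *
      Complex.exp ((σ + t * Complex.I) * x))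
    (f := fun t : ℝ => f (σ + t * Complex.I) * Complex.exp ((σ + t * Complex.I) * x))
    (fun k _ => ‖b k‖ * Real.exp (-(k * σ)) * Real.exp (σ * x))
    (fun k => Continuous.aestronglyMeasurable (by fun_prop))
    (fun k => Eventually.of_forall fun t _ => by
      rw [norm_mul, norm_mul, norm_exp_neg_natCast_mul, Complex.norm_exp]; simp)
    (Eventually.of_forall fun t _ => hsum) (by simp)
    (Eventually.of_forall fun t _ => (h _ (by simpa using hσ)).mul_right _)
  refine (key.mul_left (1 / (2 * T) : ℂ)).congr_fun ?_
  intro k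
  simp only [bohrMean]
  rw [mul_left_comm, ← intervalIntegral.integral_const_mul]
  congr 1
  refine intervalIntegral.integral_congr fun t _ => ?_
  simp only [coe_one, Pi.one_apply, one_mul]
  rw [Complex.ofReal_exp, Complex.ofReal_exp, mul_assoc, mul_assoc (b k),
    mul_assoc (b k), ← Complex.exp_add, ← Complex.exp_add, ← Complex.exp_add]
  congr 2
  push_cast
  ring

/-- Bohr coefficients of an absolutely convergent Dirichlet series `∑ bₖ exp (-k s)`. -/
theorem HasExpSeries.hasBohrCoeff {b : ℕ → ℂ} {f : ℂ → ℂ} (h : HasExpSeries b f 0) (x : ℝ) :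
    HasBohrCoeff f x (∑' k : ℕ, if x - k = 0 then b k else 0) := by
  intro σ hσ
  have hsum := (h.summable_norm hσ).mul_right (Real.exp (σ * x))
  -- The means of `1` are bounded by `1`, so the limit in `T` may be taken term by term.
  have key := tendsto_tsum_of_dominated_convergence (𝓕 := atTop)
    (f := fun (T : ℝ) (k : ℕ) =>
      b k * Real.exp (-(k * σ)) * Real.exp (σ * x) * bohrMean (x - k) T 1)
    (g := fun k : ℕ => if x - k = 0 then b k else 0) hsum ?_ ?_
  · exact key.congr fun T => (h.hasSum_bohrMean x hσ T).tsum_eq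
  · intro k
    split_ifs with hk
    · have hx : x = k := sub_eq_zero.1 hk
      refine tendsto_const_nhds.congr' ?_
      filter_upwards [eventually_gt_atTop 0] with T hT
      rw [hk, bohrMean_zero_one hT, mul_one, mul_assoc, ← Complex.ofReal_mul, ← Real.exp_add, hx]
      have : -((k : ℝ) * σ) + σ * k = 0 := by ring
      simp [this]
    · simpa using (mem_bohrMeanZero.1 (one_mem_bohrMeanZero hk)).const_mul
        (b k * Real.exp (-(k * σ)) * Real.exp (σ * x) : ℂ)
  · filter_upwards [eventually_gt_atTop 0] with T hT k
    have h1 := norm_bohrMean_le (x - k) hT 1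
    rw [norm_one] at h1
    rw [norm_mul, norm_mul, norm_mul, Complex.norm_real, Complex.norm_real,
      Real.norm_of_nonneg (Real.exp_pos _).le, Real.norm_of_nonneg (Real.exp_pos _).le]
    exact mul_le_of_le_one_right (by positivity) h1

theorem HasExpSeries.hasBohrCoeff_natCast {b : ℕ → ℂ} {f : ℂ → ℂ} (h : HasExpSeries b f 0)
    (n : ℕ) : HasBohrCoeff f n (b n) := by
  have := h.hasBohrCoeff n
  rwa [tsum_eq_single n (fun k hk => if_neg (sub_ne_zero.2 (by exact_mod_cast hk.symm))),
    if_pos (sub_self _)] at this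

theorem HasExpSeries.hasBohrCoeff_zero {b : ℕ → ℂ} {f : ℂ → ℂ} (h : HasExpSeries b f 0)
    {x : ℝ} (hx : ∀ k : ℕ, b k ≠ 0 → x ≠ k) : HasBohrCoeff f x 0 := by
  have h0 : ∀ k : ℕ, (if x - k = 0 then b k else 0) = 0 := by
    intro k
    split_ifs with hk
    · by_contra hb
      exact hx k hb (sub_eq_zero.1 hk)
    · rfl
  have := h.hasBohrCoeff x
  simpa [h0] using this

theorem HasBohrCoeff.unique {f : ℂ → ℂ} {x : ℝ} {c d : ℂ} (hc : HasBohrCoeff f x c)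
    (hd : HasBohrCoeff f x d) : c = d :=
  tendsto_nhds_unique (hc 1 one_pos) (hd 1 one_pos)

/-- Uniqueness of the coefficients of a Dirichlet series `∑ bₖ exp (-k s)`. -/
theorem HasExpSeries.unique {b d : ℕ → ℂ} {f : ℂ → ℂ} {c c' : ℝ} (hb : HasExpSeries b f c)
    (hd : HasExpSeries d f c') : b = d := by
  obtain ⟨M, h1, h2⟩ : ∃ M : ℝ, c ≤ M ∧ c' ≤ M := ⟨max c c', le_max_left _ _, le_max_right _ _⟩
  -- Shifting the variable by `M` moves both series to `[Re > 0]`, where the coefficients are Bohr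
  -- coefficients.
  have aux : ∀ {e : ℕ → ℂ} {c : ℝ}, c ≤ M → HasExpSeries e f c →
      HasExpSeries (fun k => e k * Complex.exp (-(k * M))) (fun s => f (s + M)) 0 := by
    intro e c hcM he s hs
    refine (he (s + M) (by simp; linarith)).congr_fun fun k => ?_
    rw [mul_assoc, ← Complex.exp_add]
    congr 2
    ring
  funext k
  exact mul_right_cancel₀ (Complex.exp_ne_zero _)
    (((aux h1 hb).hasBohrCoeff_natCast k).unique ((aux h2 hd).hasBohrCoeff_natCast k))

end ExpSeries

/-! ### Passage to the unit disc and the maximum principle -/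

section DiscModel

theorem isOpen_rightHalfPlane : IsOpen rightHalfPlane :=
  isOpen_lt continuous_const Complex.continuous_re

/-- A `2πi`-periodic holomorphic function on the right half-plane which is bounded far to the
right is a holomorphic function of `exp (-s)` in the unit disc. -/
theorem exists_differentiableOn_ball_of_periodic {f : ℂ → ℂ}
    (hf : DifferentiableOn ℂ f rightHalfPlane)
    (hper : ∀ s : ℂ, 0 < s.re → f (s + 2 * Real.pi * Complex.I) = f s)
    {σ B : ℝ} (hB : ∀ s : ℂ, σ ≤ s.re → ‖f s‖ ≤ B) :
    ∃ F : ℂ → ℂ, DifferentiableOn ℂ F (Metric.ball 0 1) ∧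
      ∀ s : ℂ, 0 < s.re → F (Complex.exp (-s)) = f s := by
  have hpi : (Real.pi : ℂ) ≠ 0 := by exact_mod_cast Real.pi_ne_zero
  have hpos : 0 < 2 * Real.pi := Real.two_pi_pos
  -- The rotation `w = I * s` maps to the upper half-plane, and `exp (-s)` becomes the `q`-parameter
  -- of period `2π`. The value `0` elsewhere keeps `g` periodic on all of `ℂ`.
  set g : ℂ → ℂ := fun w => if 0 < w.im then f (-Complex.I * w) else 0 with hg
  have hgval : ∀ w : ℂ, 0 < w.im → g w = f (-Complex.I * w) := fun w hw => if_pos hw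
  have hre : ∀ w : ℂ, (-Complex.I * w).re = w.im := fun w => by simp
  have hgper : Function.Periodic g ((2 * Real.pi : ℝ) : ℂ) := by
    intro w
    have him : (w + ((2 * Real.pi : ℝ) : ℂ)).im = w.im := by
      rw [Complex.add_im, Complex.ofReal_im, add_zero]
    by_cases hw : 0 < w.im
    · rw [hgval _ hw, hgval _ (him ▸ hw), ← hper]
      · congr 1
        push_cast
        ring
      · rw [hre, him]; exact hw
    · simp only [hg, him, if_neg hw]
  have hgdiff : ∀ w : ℂ, 0 < w.im → DifferentiableAt ℂ g w := by
    intro w hw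
    have h1 : DifferentiableAt ℂ f (-Complex.I * w) :=
      hf.differentiableAt (isOpen_rightHalfPlane.mem_nhds (by
        rw [rightHalfPlane, Set.mem_ofPred_eq, hre]; exact hw))
    have h2 : DifferentiableAt ℂ (fun w => f (-Complex.I * w)) w :=
      DifferentiableAt.comp w h1 (by fun_prop)
    refine h2.congr_of_eventuallyEq ?_
    filter_upwards [(isOpen_lt continuous_const Complex.continuous_im).mem_nhds hw] with z hz
    exact hgval z hz
  have hI : ∀ A : ℝ, ∀ᶠ w in comap Complex.im atTop, A < w.im := fun A =>
    tendsto_comap.eventually (eventually_gt_atTop A)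
  have hq : ∀ w : ℂ, Function.Periodic.qParam (2 * Real.pi) w = Complex.exp (Complex.I * w) := by
    intro w
    rw [Function.Periodic.qParam]
    congr 1
    push_cast
    field_simp
  refine ⟨Function.Periodic.cuspFunction (2 * Real.pi) g, fun z hz => ?_, fun s hs => ?_⟩
  · refine DifferentiableAt.differentiableWithinAt ?_
    rcases eq_or_ne z 0 with rfl | hz0
    -- Boundedness far to the right makes the singularity at `0` removable.
    · refine Function.Periodic.differentiableAt_cuspFunction_zero hpos hgper
        ((hI 0).mono hgdiff) (Asymptotics.IsBigO.of_bound B ?_)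
      filter_upwards [hI 0, hI σ] with w hw hw'
      rw [hgval w hw]
      simpa using hB (-Complex.I * w) (by rw [hre]; exact hw'.le)
    · rw [← Function.Periodic.qParam_right_inv hpos.ne' hz0]
      refine Function.Periodic.differentiableAt_cuspFunction hpos.ne' hgper (hgdiff _ ?_)
      rw [Function.Periodic.im_invQParam, neg_div, div_self hpos.ne', neg_one_mul, neg_pos]
      exact Real.log_neg (norm_pos_iff.2 hz0) (by simpa using hz)
  · have h1 := Function.Periodic.eq_cuspFunction hpos.ne' hgper (Complex.I * s)
    rw [hq, ← mul_assoc, Complex.I_mul_I, neg_one_mul, hgval _ (by simpa using hs)] at h1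
    rw [h1]
    congr 1
    rw [neg_mul, ← mul_assoc, Complex.I_mul_I]
    ring

theorem hasExpSeries_of_differentiableOn_ball {F f : ℂ → ℂ}
    (hF : DifferentiableOn ℂ F (Metric.ball 0 1))
    (hFf : ∀ s : ℂ, 0 < s.re → F (Complex.exp (-s)) = f s) :
    HasExpSeries (fun k => ((k.factorial : ℂ))⁻¹ * iteratedDeriv k F 0) f 0 := by
  intro s hs
  have hmem : Complex.exp (-s) ∈ Metric.ball (0 : ℂ) 1 := by
    simpa [Complex.norm_exp] using hs
  have h := Complex.hasSum_taylorSeries_on_ball hF hmem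
  rw [hFf s hs] at h
  refine h.congr_fun fun k => ?_
  rw [sub_zero, ← Complex.exp_nat_mul, smul_eq_mul, smul_eq_mul, mul_neg]
  ring

/-- Maximum principle: a polynomial bound on `f s = F (exp (-s))` gives a uniform bound. -/
theorem norm_le_of_norm_div_le {F f : ℂ → ℂ} (hF : DifferentiableOn ℂ F (Metric.ball 0 1))
    (hFf : ∀ s : ℂ, 0 < s.re → F (Complex.exp (-s)) = f s) {ℓ M : ℝ} (hℓ : 0 ≤ ℓ)
    (hM : ∀ s : ℂ, 0 < s.re → ‖f s‖ / (1 + ‖s‖) ^ ℓ ≤ M) (s : ℂ) (hs : 0 < s.re) :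
    ‖f s‖ ≤ (2 + Real.pi) ^ ℓ * M := by
  -- Capping at `1` keeps the weight on the circle of radius `exp (-σ)` bounded, while `exp (-s)`
  -- stays in the closed disc.
  set σ := min s.re 1 with hσ
  have hσ0 : 0 < σ := lt_min hs one_pos
  have hσ1 : σ ≤ 1 := min_le_right _ _
  set r := Real.exp (-σ) with hr
  have hr0 : 0 < r := Real.exp_pos _
  have hr1 : r < 1 := by simpa [hr] using hσ0
  have hM0 : 0 ≤ M := (by positivity : (0 : ℝ) ≤ ‖f 1‖ / (1 + ‖(1 : ℂ)‖) ^ ℓ).trans (hM 1 (by simp))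
  rw [← hFf s hs]
  refine Complex.norm_le_of_forall_mem_frontier_norm_le (U := Metric.ball 0 r)
    Metric.isBounded_ball ?_ ?_ ?_
  · refine DifferentiableOn.diffContOnCl (hF.mono ?_)
    rw [closure_ball _ hr0.ne']
    exact Metric.closedBall_subset_ball hr1
  · intro z hz
    rw [frontier_ball _ hr0.ne', mem_sphere_zero_iff_norm] at hz
    have hz0 : z ≠ 0 := norm_pos_iff.1 (hz ▸ hr0)
    -- The principal logarithm gives a preimage with imaginary part at most `π` in modulus, whence
    -- `1 + σ + π ≤ 2 + π`.
    have hwre : (-Complex.log z).re = σ := by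
      rw [Complex.neg_re, Complex.log_re, hz, hr, Real.log_exp, neg_neg]
    have hz' : z = Complex.exp (- -Complex.log z) := by rw [neg_neg, Complex.exp_log hz0]
    have hpos : 0 < (-Complex.log z).re := by rw [hwre]; exact hσ0
    rw [hz', hFf _ hpos]
    have h1 := hM _ hpos
    rw [div_le_iff₀ (by positivity), mul_comm] at h1
    refine h1.trans (mul_le_mul_of_nonneg_right ?_ hM0)
    refine Real.rpow_le_rpow (by positivity) ?_ hℓ
    have h2 := Complex.norm_le_abs_re_add_abs_im (-Complex.log z)
    rw [hwre, abs_of_pos hσ0, Complex.neg_im, abs_neg, Complex.log_im] at h2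
    linarith [Complex.abs_arg_le_pi z]
  · rw [closure_ball _ hr0.ne', mem_closedBall_zero_iff, Complex.norm_exp, Complex.neg_re]
    exact Real.exp_le_exp.2 (neg_le_neg (min_le_left _ _))

end DiscModel

/-! ### Riesz means and growth of the coefficients of a germ -/

section RieszMeans

/-- Riesz means of an absolutely convergent Dirichlet series converge to its sum. -/
theorem tendsto_rieszMean (lam : Frequency) {k : ℝ} (hk : 0 ≤ k) (a : ℕ → ℂ) (s : ℂ)
    (h : Summable fun n => a n * Complex.exp (-(lam.seq n : ℂ) * s)) :
    Tendsto (fun x => rieszMean lam k a x s) atTop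
      (𝓝 (∑' n, a n * Complex.exp (-(lam.seq n : ℂ) * s))) := by
  have key := tendsto_tsum_of_dominated_convergence (𝓕 := atTop)
    (f := fun (x : ℝ) (n : ℕ) => if lam.seq n < x then
      a n * Complex.exp (-(lam.seq n : ℂ) * s) * (((1 - lam.seq n / x) ^ k : ℝ) : ℂ) else 0)
    (g := fun n => a n * Complex.exp (-(lam.seq n : ℂ) * s)) h.norm ?_ ?_
  · refine key.congr fun x => ?_
    rw [rieszMean, tsum_eq_sum (s := (lam.finite_lt x).toFinset)]
    · exact Finset.sum_congr rfl fun n hn => if_pos (by simpa using hn)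
    · intro n hn
      exact if_neg (by simpa using hn)
  · intro n
    have h1 : Tendsto (fun x : ℝ => (1 - lam.seq n / x) ^ k) atTop (𝓝 ((1 - 0) ^ k)) :=
      (tendsto_const_nhds.sub (tendsto_const_nhds.div_atTop tendsto_id)).rpow_const
        (Or.inl (by norm_num))
    rw [sub_zero, Real.one_rpow] at h1
    have h2 := ((Complex.continuous_ofReal.tendsto 1).comp h1).const_mul
      (a n * Complex.exp (-(lam.seq n : ℂ) * s))
    rw [Complex.ofReal_one, mul_one] at h2
    refine h2.congr' ?_
    filter_upwards [eventually_gt_atTop (lam.seq n)] with x hx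
    rw [if_pos hx, Function.comp_apply]
  · filter_upwards with x n
    split_ifs with hx
    · have hx0 : 0 < x := (lam.nonneg n).trans_lt hx
      have h1 : 0 ≤ 1 - lam.seq n / x := by
        rw [sub_nonneg, div_le_one hx0]; exact hx.le
      have h2 : 1 - lam.seq n / x ≤ 1 := by
        have := div_nonneg (lam.nonneg n) hx0.le
        linarith
      rw [norm_mul, Complex.norm_real, Real.norm_of_nonneg (Real.rpow_nonneg h1 k)]
      exact mul_le_of_le_one_right (norm_nonneg _) (Real.rpow_le_one h1 h2 hk)
    · simp

/-- A discrete Gronwall inequality: `B * 2 ^ N` solves the recursion with equality. -/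
theorem le_mul_two_pow_of_le_add_sum {d : ℕ → ℝ} {B : ℝ}
    (h : ∀ N, d N ≤ B + ∑ n ∈ Finset.range N, d n) (N : ℕ) : d N ≤ B * 2 ^ N := by
  induction N using Nat.strong_induction_on with
  | _ N ih =>
    have h1 : ∑ n ∈ Finset.range N, d n ≤ ∑ n ∈ Finset.range N, B * 2 ^ n :=
      Finset.sum_le_sum fun n hn => ih n (Finset.mem_range.1 hn)
    rw [← Finset.mul_sum, geom_sum_eq (by norm_num)] at h1
    have := h N
    norm_num at h1
    linarith

theorem natCast_add_one_rpow_le (j : ℕ) {m : ℝ} (hm : 0 ≤ m) :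
    ((j : ℝ) + 1) ^ m ≤ ((2 : ℝ) ^ m) ^ j := by
  have h1 : ((j : ℝ) + 1) ≤ 2 ^ j := by exact_mod_cast Nat.lt_two_pow_self
  calc ((j : ℝ) + 1) ^ m ≤ ((2 : ℝ) ^ j) ^ m := Real.rpow_le_rpow (by positivity) h1 hm
    _ = ((2 : ℝ) ^ m) ^ j := by
      rw [← Real.rpow_natCast, ← Real.rpow_natCast, ← Real.rpow_mul (by norm_num),
        ← Real.rpow_mul (by norm_num), mul_comm]

theorem powerFrequency_seq (n₀ n : ℕ) : (powerFrequency n₀).seq n = (n₀ : ℝ) + n := by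
  simp [powerFrequency]

/-- Sampling at one past the `N`-th frequency makes that term the last, with weight numerator
exactly `1`. -/
theorem rieszMean_powerFrequency (n₀ N : ℕ) (m : ℝ) (a : ℕ → ℂ) (s : ℂ) :
    rieszMean (powerFrequency n₀) m a (n₀ + N + 1) s =
      ∑ n ∈ Finset.range (N + 1), a n * Complex.exp (-((powerFrequency n₀).seq n : ℂ) * s) *
        (((((N - n : ℕ) : ℝ) + 1) ^ m / ((n₀ : ℝ) + N + 1) ^ m : ℝ) : ℂ) := by
  rw [rieszMean]
  have hset : ((powerFrequency n₀).finite_lt (n₀ + N + 1)).toFinset = Finset.range (N + 1) := by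
    ext n
    rw [Set.Finite.mem_toFinset, Set.mem_ofPred_eq, powerFrequency_seq, Finset.mem_range,
      add_assoc, add_lt_add_iff_left]
    exact_mod_cast Iff.rfl
  rw [hset]
  refine Finset.sum_congr rfl fun n hn => ?_
  have hn' : n ≤ N := Nat.lt_succ_iff.1 (Finset.mem_range.1 hn)
  have hx : (0 : ℝ) < n₀ + N + 1 := by positivity
  congr 2
  rw [← Real.div_rpow (by positivity) hx.le, powerFrequency_seq, Nat.cast_sub hn']
  congr 1
  field_simp
  ring

/-- The coefficients of a Riesz germ grow at most exponentially. -/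
theorem IsRieszGerm.exists_norm_coeff_le {n₀ : ℕ} {a : ℕ → ℂ} {f : ℂ → ℂ}
    (h : IsRieszGerm (powerFrequency n₀) a f) :
    ∃ A K : ℝ, 0 < K ∧ ∀ n, ‖a n‖ ≤ A * K ^ n := by
  obtain ⟨m, hm, σ, -, hlim⟩ := h
  have hseq : Tendsto (fun N : ℕ => rieszMean (powerFrequency n₀) m a (n₀ + N + 1)
      ((σ + 1 : ℝ) : ℂ)) atTop (𝓝 (f ((σ + 1 : ℝ) : ℂ))) := by
    refine (hlim ((σ + 1 : ℝ) : ℂ) (by simp)).comp ?_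
    refine tendsto_atTop_mono (fun N : ℕ => ?_) (tendsto_natCast_atTop_atTop (R := ℝ))
    have : (0 : ℝ) ≤ n₀ := Nat.cast_nonneg _
    linarith
  obtain ⟨B, hB⟩ := (Metric.isBounded_range_of_tendsto _ hseq).exists_norm_le
  have hB' : ∀ N : ℕ, ‖rieszMean (powerFrequency n₀) m a (n₀ + N + 1) ((σ + 1 : ℝ) : ℂ)‖ ≤ B :=
    fun N => hB _ ⟨N, rfl⟩
  have hB0 : 0 ≤ B := (norm_nonneg _).trans (hB' 0)
  set c : ℕ → ℂ := fun n => a n * Complex.exp (-((powerFrequency n₀).seq n : ℂ) *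
    ((σ + 1 : ℝ) : ℂ)) with hc
  set q : ℝ := (2 : ℝ) ^ m with hq
  have hq0 : 0 < q := by positivity
  -- The bounded Riesz mean is solved for its last term. Division by `q ^ N` absorbs both the factor
  -- `x ^ m`, with `x = n₀ + N + 1`, and the weights `(N - n + 1) ^ m ≤ q ^ (N - n)`.
  have hrec : ∀ N : ℕ, ‖c N‖ / q ^ N ≤ B * ((n₀ : ℝ) + 1) ^ m +
      ∑ n ∈ Finset.range N, ‖c n‖ / q ^ n := by
    intro N
    have hx : (0 : ℝ) < n₀ + N + 1 := by positivity
    have hxm : (0 : ℝ) < ((n₀ : ℝ) + N + 1) ^ m := by positivity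
    have h1 := hB' N
    rw [rieszMean_powerFrequency, Finset.sum_range_succ, Nat.sub_self, Nat.cast_zero, zero_add,
      Real.one_rpow] at h1
    have h2 := norm_sub_le_of_le h1 (norm_sum_le (Finset.range N) fun n =>
      c n * ((((((N - n : ℕ) : ℝ) + 1) ^ m / ((n₀ : ℝ) + N + 1) ^ m : ℝ)) : ℂ))
    rw [add_sub_cancel_left] at h2
    simp only [norm_mul _ (Complex.ofReal _), Complex.norm_real] at h2
    rw [Real.norm_of_nonneg (by positivity : 0 ≤ 1 / ((n₀ : ℝ) + N + 1) ^ m), mul_one_div,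
      div_le_iff₀ hxm, add_mul, Finset.sum_mul] at h2
    have h3 : B * ((n₀ : ℝ) + N + 1) ^ m ≤ B * ((n₀ : ℝ) + 1) ^ m * q ^ N := by
      rw [mul_assoc]
      refine mul_le_mul_of_nonneg_left ?_ hB0
      calc ((n₀ : ℝ) + N + 1) ^ m ≤ (((n₀ : ℝ) + 1) * (N + 1)) ^ m := by
            refine Real.rpow_le_rpow hx.le ?_ hm
            have : (0 : ℝ) ≤ n₀ * N := by positivity
            nlinarith
        _ = ((n₀ : ℝ) + 1) ^ m * ((N : ℝ) + 1) ^ m := Real.mul_rpow (by positivity) (by positivity)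
        _ ≤ _ := mul_le_mul_of_nonneg_left (natCast_add_one_rpow_le N hm) (by positivity)
    rw [div_le_iff₀ (by positivity), add_mul, Finset.sum_mul]
    refine h2.trans (add_le_add h3 (Finset.sum_le_sum fun n hn => ?_))
    have hn' : n ≤ N := (Finset.mem_range.1 hn).le
    rw [Real.norm_of_nonneg (by positivity), mul_assoc, div_mul_cancel₀ _ hxm.ne',
      div_mul_eq_mul_div, mul_div_assoc]
    refine mul_le_mul_of_nonneg_left ?_ (norm_nonneg _)
    rw [div_eq_mul_inv, ← pow_sub₀ q hq0.ne' hn']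
    exact natCast_add_one_rpow_le (N - n) hm
  have hgr := le_mul_two_pow_of_le_add_sum hrec
  refine ⟨B * ((n₀ : ℝ) + 1) ^ m * Real.exp (n₀ * (σ + 1)), 2 * q * Real.exp (σ + 1),
    by positivity, fun n => ?_⟩
  have h1 := hgr n
  rw [div_le_iff₀ (by positivity)] at h1
  have h2 : ‖c n‖ = ‖a n‖ * Real.exp (-((n₀ + n) * (σ + 1))) := by
    simp only [hc]
    rw [norm_mul, Complex.norm_exp, powerFrequency_seq]
    congr 2
    rw [neg_mul, Complex.neg_re, ← Complex.ofReal_mul, Complex.ofReal_re]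
  rw [h2, Real.exp_neg, ← div_eq_mul_inv, div_le_iff₀ (Real.exp_pos _)] at h1
  refine h1.trans (le_of_eq ?_)
  rw [add_mul, Real.exp_add, Real.exp_nat_mul, mul_pow, mul_pow]
  have := Real.exp_nat_mul (σ + 1) n
  rw [this]
  ring

/-- Reindexing of a Dirichlet series with frequency `n₀, n₀ + 1, …` by the natural numbers. -/
def shiftCoeff (n₀ : ℕ) (a : ℕ → ℂ) (k : ℕ) : ℂ := if n₀ ≤ k then a (k - n₀) else 0

theorem hasSum_shiftCoeff (n₀ : ℕ) (a : ℕ → ℂ) (s v : ℂ) :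
    HasSum (fun k : ℕ => shiftCoeff n₀ a k * Complex.exp (-(k * s))) v ↔
      HasSum (fun n => a n * Complex.exp (-((powerFrequency n₀).seq n : ℂ) * s)) v := by
  rw [← (add_right_injective n₀).hasSum_iff]
  · refine iff_of_eq (congrArg (HasSum · v) (funext fun n => ?_))
    rw [Function.comp_apply, shiftCoeff, if_pos (Nat.le_add_right _ _), Nat.add_sub_cancel_left,
      powerFrequency_seq]
    push_cast
    rw [neg_mul]
  · intro k hk
    rw [shiftCoeff, if_neg, zero_mul]
    intro hle
    exact hk ⟨k - n₀, Nat.add_sub_cancel' hle⟩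

/-- Exponential growth of the coefficients gives absolute convergence for `Re s > log K`; there the
Riesz means tend to the sum, which must then be `f s`. -/
theorem IsRieszGerm.exists_hasExpSeries {n₀ : ℕ} {a : ℕ → ℂ} {f : ℂ → ℂ}
    (h : IsRieszGerm (powerFrequency n₀) a f) : ∃ c : ℝ, HasExpSeries (shiftCoeff n₀ a) f c := by
  obtain ⟨A, K, hK, hA⟩ := h.exists_norm_coeff_le
  obtain ⟨m, hm, σ, -, hlim⟩ := h
  refine ⟨max σ (Real.log K), fun s hs => ?_⟩
  have hsσ : σ < s.re := (le_max_left _ _).trans_lt hs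
  have hsK : K < Real.exp s.re := by
    rw [← Real.log_lt_iff_lt_exp hK]; exact (le_max_right _ _).trans_lt hs
  have hsum : Summable fun n => a n * Complex.exp (-((powerFrequency n₀).seq n : ℂ) * s) := by
    have hgeo : Summable fun n : ℕ => A * Real.exp (-(n₀ * s.re)) * (K * Real.exp (-s.re)) ^ n := by
      refine Summable.mul_left _ (summable_geometric_of_lt_one (by positivity) ?_)
      rw [Real.exp_neg, ← div_eq_mul_inv, div_lt_one (Real.exp_pos _)]
      exact hsK
    refine hgeo.of_norm_bounded fun n => ?_
    have : (-((powerFrequency n₀).seq n : ℂ) * s).re = -(n₀ * s.re) + n * -s.re := by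
      rw [powerFrequency_seq, ← Complex.ofReal_neg, Complex.re_ofReal_mul]
      ring
    rw [norm_mul, Complex.norm_exp, this, Real.exp_add, Real.exp_nat_mul, mul_pow]
    have h1 := mul_le_mul_of_nonneg_right (hA n)
      (by positivity : 0 ≤ Real.exp (-(n₀ * s.re)) * Real.exp (-s.re) ^ n)
    linarith
  rw [hasSum_shiftCoeff, tendsto_nhds_unique (hlim s hsσ) (tendsto_rieszMean _ hm a s hsum)]
  exact hsum.hasSum

end RieszMeans

/-! ### Both spaces as power series in `exp (-s)` -/

section Spaces

theorem uniformlyAlmostPeriodic_of_periodic {g : ℝ → ℂ} (hg : Continuous g) {P : ℝ} (hP : 0 < P)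
    (hper : Function.Periodic g P) : UniformlyAlmostPeriodic g := by
  refine ⟨hg, fun ε hε => ⟨P, hP, fun b => ?_⟩⟩
  obtain ⟨n, hn, -⟩ := existsUnique_add_zsmul_mem_Ico hP 0 b
  rw [zero_add] at hn
  refine ⟨n • P, ⟨hn.1, hn.2.le⟩, fun t => ?_⟩
  rw [hper.zsmul n t, sub_self, norm_zero]
  exact hε.le

/-- The common description of the spaces: `f s = F (exp (-s)) = ∑ bₖ exp (-k s)` on `[Re > 0]`
with `F` holomorphic in the unit disc and `bₖ = 0` for `k < n₀`. -/
def IsPowerSeriesLift (n₀ : ℕ) (f F : ℂ → ℂ) (b : ℕ → ℂ) : Prop :=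
  DifferentiableOn ℂ F (Metric.ball 0 1) ∧ (∀ s : ℂ, 0 < s.re → F (Complex.exp (-s)) = f s) ∧
    HasExpSeries b f 0 ∧ ∀ k < n₀, b k = 0

/-- Periodicity holds where the germ converges absolutely and spreads by the identity theorem. The
Taylor coefficients of the lift are the germ's by uniqueness, so none occur below `n₀`. -/
theorem exists_isPowerSeriesLift_of_mem_HInftyScale {n₀ : ℕ} {ℓ : ℝ} {f : ℂ → ℂ}
    (hf : f ∈ HInftyScale (powerFrequency n₀) ℓ) : ∃ F b, IsPowerSeriesLift n₀ f F b := by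
  obtain ⟨hd, ⟨a, ha⟩, -⟩ := hf
  obtain ⟨c, hc⟩ := ha.exists_hasExpSeries
  have hre : ∀ s : ℂ, (s + 2 * Real.pi * Complex.I).re = s.re := fun s => by simp
  have hd' : DifferentiableOn ℂ (fun s => f (s + 2 * Real.pi * Complex.I)) rightHalfPlane :=
    hd.comp (by fun_prop) fun s hs => by
      rw [rightHalfPlane, Set.mem_ofPred_eq, hre]; exact hs
  obtain ⟨s₀, hs₀, hcs₀⟩ : ∃ s₀ : ℂ, 0 < s₀.re ∧ c < s₀.re :=
    ⟨((max 0 c + 1 : ℝ) : ℂ), by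
      rw [Complex.ofReal_re]; exact (le_max_left 0 c).trans_lt (lt_add_one _), by
      rw [Complex.ofReal_re]; exact (le_max_right 0 c).trans_lt (lt_add_one _)⟩
  have hper : ∀ s : ℂ, 0 < s.re → f (s + 2 * Real.pi * Complex.I) = f s := by
    refine (hd'.analyticOnNhd isOpen_rightHalfPlane).eqOn_of_preconnected_of_eventuallyEq
      (hd.analyticOnNhd isOpen_rightHalfPlane) (convex_halfSpace_re_gt 0).isPreconnected
      (z₀ := s₀) hs₀ ?_
    filter_upwards [(isOpen_lt continuous_const Complex.continuous_re).mem_nhds hcs₀] with s hs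
    exact hc.add_two_pi_I hs
  obtain ⟨B, hB⟩ := hc.exists_norm_le (lt_add_one c)
  obtain ⟨F, hF, hFf⟩ := exists_differentiableOn_ball_of_periodic hd hper hB
  have hser := hasExpSeries_of_differentiableOn_ball hF hFf
  refine ⟨F, _, hF, hFf, hser, fun k hk => ?_⟩
  rw [congrFun (hser.unique hc) k, shiftCoeff, if_neg (not_le.2 hk)]

theorem natCast_notMem_range_powerFrequency {n₀ k : ℕ} (hk : k < n₀) :
    (k : ℝ) ∉ Set.range (powerFrequency n₀).seq := by
  rintro ⟨n, hn⟩
  rw [powerFrequency_seq] at hn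
  have : n₀ + n = k := by exact_mod_cast hn
  omega

theorem periodic_of_mem_HInfty {n₀ : ℕ} {f : ℂ → ℂ} (hf : f ∈ HInfty (powerFrequency n₀))
    (s : ℂ) (hs : 0 < s.re) : f (s + 2 * Real.pi * Complex.I) = f s := by
  obtain ⟨-, ⟨B, hB⟩, hap, hcoeff⟩ := hf
  have hB' : ∀ s : ℂ, 0 < s.re → ‖f s‖ ≤ B := fun s hs => hB ⟨⟨s, hs⟩, rfl⟩
  set u : BoundedContinuousFunction ℝ ℂ := BoundedContinuousFunction.ofNormedAddCommGroup
    (fun t : ℝ => f (s.re + t * Complex.I)) (hap s.re hs).1 B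
    (fun t => hB' _ (by simpa using hs)) with hu
  have hmean : ∀ x : ℝ, x ∉ Set.range ((↑) : ℤ → ℝ) → u ∈ bohrMeanZero x := by
    intro x hx
    have hx' : x ∉ Set.range (powerFrequency n₀).seq := by
      rintro ⟨n, rfl⟩
      exact hx ⟨((n₀ + n : ℕ) : ℤ), by simp [powerFrequency]⟩
    -- The factor `exp (-σx)`, `σ = Re s`, converts the Bohr coefficient into the mean on the line.
    have h1 := (hcoeff x hx' s.re hs).const_mul (Complex.exp (-(s.re * x)))
    rw [mul_zero] at h1
    rw [mem_bohrMeanZero]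
    refine h1.congr fun T => ?_
    rw [bohrMean, mul_left_comm, ← intervalIntegral.integral_const_mul]
    congr 1
    refine intervalIntegral.integral_congr fun t _ => ?_
    simp only [hu, BoundedContinuousFunction.coe_ofNormedAddCommGroup]
    rw [mul_left_comm, ← Complex.exp_add]
    congr 2
    ring
  have h := congrArg (fun g : BoundedContinuousFunction ℝ ℂ => g s.im)
    (translation_two_pi_eq_self (u := u) (hap s.re hs) hmean)
  simp only [translation_apply, hu, BoundedContinuousFunction.coe_ofNormedAddCommGroup] at h
  rw [Complex.re_add_im] at h
  rw [← h]
  congr 1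
  conv_lhs => rw [← Complex.re_add_im s]
  push_cast
  ring

theorem exists_isPowerSeriesLift_of_mem_HInfty {n₀ : ℕ} {f : ℂ → ℂ}
    (hf : f ∈ HInfty (powerFrequency n₀)) : ∃ F b, IsPowerSeriesLift n₀ f F b := by
  have hper := periodic_of_mem_HInfty hf
  obtain ⟨hd, ⟨B, hB⟩, -, hcoeff⟩ := hf
  obtain ⟨F, hF, hFf⟩ := exists_differentiableOn_ball_of_periodic hd hper (σ := 1) (B := B)
    fun s hs => hB ⟨⟨s, one_pos.trans_le hs⟩, rfl⟩
  have hser := hasExpSeries_of_differentiableOn_ball hF hFf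
  -- For `k < n₀` the `k`-th Taylor coefficient is the Bohr coefficient at `k`, which vanishes by
  -- hypothesis.
  exact ⟨F, _, hF, hFf, hser, fun k hk => (hser.hasBohrCoeff_natCast k).unique
    (hcoeff k (natCast_notMem_range_powerFrequency hk))⟩

theorem IsPowerSeriesLift.isRieszGerm {n₀ : ℕ} {f F : ℂ → ℂ} {b : ℕ → ℂ}
    (h : IsPowerSeriesLift n₀ f F b) :
    IsRieszGerm (powerFrequency n₀) (fun n => b (n₀ + n)) f := by
  obtain ⟨-, -, hser, hb⟩ := h
  have hshift : shiftCoeff n₀ (fun n => b (n₀ + n)) = b := by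
    funext k
    rw [shiftCoeff]
    split_ifs with hk
    · rw [Nat.add_sub_cancel' hk]
    · exact (hb k (not_le.1 hk)).symm
  -- The series converges absolutely on all of `[Re > 0]`, so order `0` and abscissa `0` suffice.
  refine ⟨0, le_rfl, 0, le_rfl, fun s hs => ?_⟩
  have h1 := hser s hs
  rw [← hshift, hasSum_shiftCoeff] at h1
  rw [← h1.tsum_eq]
  exact tendsto_rieszMean _ le_rfl _ s h1.summable

theorem IsPowerSeriesLift.mem_HInfty {n₀ : ℕ} {f F : ℂ → ℂ} {b : ℕ → ℂ}
    (h : IsPowerSeriesLift n₀ f F b) (hd : DifferentiableOn ℂ f rightHalfPlane)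
    (hbdd : BddAbove (Set.range fun s : rightHalfPlane => ‖f s‖)) :
    f ∈ HInfty (powerFrequency n₀) := by
  obtain ⟨-, -, hser, hb⟩ := h
  refine ⟨hd, hbdd, fun σ hσ => ?_, fun x hx => hser.hasBohrCoeff_zero fun k hk hxk => hx ?_⟩
  · refine uniformlyAlmostPeriodic_of_periodic ?_ Real.two_pi_pos fun t => ?_
    · refine hd.continuousOn.comp_continuous (by fun_prop) fun t => ?_
      simpa [rightHalfPlane] using hσ
    · rw [← hser.add_two_pi_I (s := σ + t * Complex.I) (by simpa using hσ)]
      congr 1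
      push_cast
      ring
  · have hn : n₀ ≤ k := not_lt.1 fun hlt => hk (hb k hlt)
    exact ⟨k - n₀, by rw [powerFrequency_seq, hxk, Nat.cast_sub hn]; ring⟩

theorem norm_div_rpow_le_norm {ℓ : ℝ} (hℓ : 0 ≤ ℓ) (f : ℂ → ℂ) (s : ℂ) :
    ‖f s‖ / (1 + ‖s‖) ^ ℓ ≤ ‖f s‖ :=
  div_le_self (norm_nonneg _) (Real.one_le_rpow (by linarith [norm_nonneg s]) hℓ)

theorem bddAbove_norm_div_rpow {ℓ : ℝ} (hℓ : 0 ≤ ℓ) {f : ℂ → ℂ}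
    (hf : BddAbove (Set.range fun s : rightHalfPlane => ‖f s‖)) :
    BddAbove (Set.range fun s : rightHalfPlane => ‖f s‖ / (1 + ‖(s : ℂ)‖) ^ ℓ) := by
  obtain ⟨B, hB⟩ := hf
  refine ⟨B, ?_⟩
  rintro _ ⟨s, rfl⟩
  exact (norm_div_rpow_le_norm hℓ f s).trans (hB ⟨s, rfl⟩)

end Spaces

end RieszScale

theorem mainTheorem12 (n₀ : ℕ) (ℓ : ℝ) (hℓ : 0 ≤ ℓ) :
    RieszScale.HInftyScale (RieszScale.powerFrequency n₀) ℓ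
        = RieszScale.HInfty (RieszScale.powerFrequency n₀) ∧
      ∃ C : ℝ, ∀ f ∈ RieszScale.HInfty (RieszScale.powerFrequency n₀),
        RieszScale.scaleNorm ℓ f ≤ RieszScale.supNorm f ∧
          RieszScale.supNorm f ≤ C * RieszScale.scaleNorm ℓ f := by
  refine ⟨Set.Subset.antisymm (fun f hf => ?_) (fun f hf => ?_),
    -- The constant comes from the maximum principle and does not depend on `n₀`.
    (2 + Real.pi) ^ ℓ, fun f hf => ?_⟩
  · obtain ⟨F, b, h⟩ := RieszScale.exists_isPowerSeriesLift_of_mem_HInftyScale hf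
    obtain ⟨M, hM⟩ := hf.2.2
    refine h.mem_HInfty hf.1 ⟨(2 + Real.pi) ^ ℓ * M, ?_⟩
    rintro _ ⟨s, rfl⟩
    exact RieszScale.norm_le_of_norm_div_le h.1 h.2.1 hℓ
      (fun s hs => hM ⟨⟨s, hs⟩, rfl⟩) s s.2
  · obtain ⟨F, b, h⟩ := RieszScale.exists_isPowerSeriesLift_of_mem_HInfty hf
    exact ⟨hf.1, ⟨_, h.isRieszGerm⟩, RieszScale.bddAbove_norm_div_rpow hℓ hf.2.1⟩
  · obtain ⟨F, b, h⟩ := RieszScale.exists_isPowerSeriesLift_of_mem_HInfty hf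
    have hbdd := RieszScale.bddAbove_norm_div_rpow hℓ hf.2.1
    have : Nonempty RieszScale.rightHalfPlane := ⟨⟨1, by simp [RieszScale.rightHalfPlane]⟩⟩
    refine ⟨ciSup_mono hf.2.1 fun s => RieszScale.norm_div_rpow_le_norm hℓ f s,
      ciSup_le fun s => ?_⟩
    exact RieszScale.norm_le_of_norm_div_le h.1 h.2.1 hℓ
      (fun s hs => le_ciSup hbdd ⟨s, hs⟩) s s.2
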